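/- **Setting.** All dimensions and block sizes below are non-negative integers. *FALPVs.* Let $\mathbb P=[-1,1]^{n_p}$ and let $\psi=(\psi_1,\dots,\psi_{n_\psi}):\mathbb P\to\mathbb R^{n_\psi}$ be such that the functions $1,\psi_1,\dots,\psi_{n_\psi}$ are linearly independent. An FALPV $\Sigma$ (with respect to $\psi$, with fixed numbers $n_u$ of inputs and $n_y$ of outputs) is given by real matrices $A_l,B_l,C_l,D_l$, $0\le l\le n_\psi$, with $A_l\in\mathbb R^{n_x\times n_x}$, $B_l\in\mathbb R^{n_x\times n_u}$, $C_l\in\mathbb R^{n_y\times n_x}$, $D_l\in\mathbb R^{n_y\times n_u}$; its dimension is $n_x$. With $X(\mathbf p)=X_0+\sum_{l=1}^{n_\psi}X_l\psi_l(\mathbf p)$ for $X=A,B,C,D$, a solution is a tuple of signals $(x,y,u,p)$ on $\mathbb N$, with $p(t)\in\mathbb P$, such that for all $t\in\mathbb N$ $$x(t+1)=A(p(t))x(t)+B(p(t))u(t),\qquad y(t)=C(p(t))x(t)+D(p(t))u(t).$$ The input-output map of $\Sigma$ sends $(u,p)$ to the output $y$ of the solution with $x(0)=0$. Two FALPVs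 (possibly of different dimensions) are input-output equivalent if their input-output maps coincide; $\Sigma$ is minimal if no input-output equivalent FALPV has smaller dimension. *LFTs.* An LFT with $d$ blocks is a tuple $M=(p,m,d,\{n_i\}_{i=1}^d,A,B,C,D)$ with $A\in\mathbb R^{n\times n}$, $B\in\mathbb R^{n\times m}$, $C\in\mathbb R^{p\times n}$, $D\in\mathbb R^{p\times m}$, $n=\sum_i n_i=:\dim M$; let $A_{i,j},B_i,C_i$ be the blocks of $A,B,C$ in the partition $n=n_1+\dots+n_d$. Its formal input-output map $Y_M$, defined on finite words over $\{1,\dots,d\}$, is $Y_M(\epsilon)=D$, $Y_M(i_1)=C_{i_1}B_{i_1}$, $Y_M(i_1\cdots i_k)=C_{i_k}A_{i_k,i_{k-1}}\cdots A_{i_2,i_1}B_{i_1}$ for $k>1$. Two LFTs with the same $p,m,d$ are formally input-output equivalent if their formal input-output maps coincide; $M$ is minimal if no formally input-output equivalent LFT has smaller dimension; $M$ is stable if there are positive definite $P_i\in\mathbb R^{n_i\times n_i}$ such that $P=\mathrm{Diag}[P_1,\dots,P_d]$ satisfies $A^TPA-P<0$. For linear operators $\delta_i$ on real sequences and $\Delta=\mathrm{Diag}[\delta_1I_{n_1},\dots,\delta_dI_{n_d}]$,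 a solution of $M$ for $\Delta$ is a tuple $(z,y,u)$ of signals such that $z=Aw+Bu$ and $y=Cw+Du$ (pointwise in time) with $w=\Delta z$. *Recognizability.* $\psi$ is recognizable if it has a realization, i.e. a minimal and stable LFT $M=(n_\psi,1,n_p,\{n_i\}_{i=1}^{n_p},F,G,H,0)$ with $\psi(\mathbf p)=H\Delta_{\mathbf p}(I-F\Delta_{\mathbf p})^{-1}G$ for all $\mathbf p\in\mathbb P$, where $\Delta_{\mathbf p}=\mathrm{Diag}[\mathbf p_1I_{n_1},\dots,\mathbf p_{n_p}I_{n_{n_p}}]$. *The associated LFT.* Fix a realization $M$ of $\psi$, the same for all FALPVs, let $S=(S^1,\dots,S^{n_\psi})^T$ be its formal input-output map, and put $\tilde S_\Sigma(\nu)=\sum_{l=1}^{n_\psi}S^l(\nu)\begin{bmatrix}A_l&B_l\\C_l&D_l\end{bmatrix}$. Let $\mathcal M(\Sigma,\psi)=(n_x+n_y,n_x+n_u,n_p,\{\bar n_i\},\mathcal F,\mathcal G,\mathcal H,0)$ be any minimal and stable LFT whose formal input-output map is $\tilde S_\Sigma$, and partition $\mathcal H=\begin{bmatrix}\mathcal H_x\\\mathcal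 H_y\end{bmatrix}$, $\mathcal G=\begin{bmatrix}\mathcal G_x&\mathcal G_u\end{bmatrix}$ ($\mathcal H_x$ has $n_x$ rows, $\mathcal G_x$ has $n_x$ columns). The LFT associated with $\Sigma$ is $$\mathcal M(\Sigma)=\Bigl(n_y,\,n_u,\,n_p+1,\,(n_x,\bar n_1,\dots,\bar n_{n_p}),\,\begin{bmatrix}A_0&\mathcal H_x\\\mathcal G_x&\mathcal F\end{bmatrix},\,\begin{bmatrix}B_0\\\mathcal G_u\end{bmatrix},\,\begin{bmatrix}C_0&\mathcal H_y\end{bmatrix},\,D_0\Bigr).$$ For a scheduling signal $p$ let $\Delta(p)=\mathrm{Diag}[\lambda I_{n_x},p_1I_{\bar n_1},\dots,p_{n_p}I_{\bar n_{n_p}}]$, where $p_i$ acts by pointwise multiplication and $\lambda$ is the backward shift, $(\lambda z)(t)=z(t-1)$ for $t\ge1$ and $(\lambda z)(0)=0$. A solution of $\mathcal M(\Sigma)$ for $\Delta(p)$ with initial state $\xi\in\mathbb R^{n_x}$ is defined like a solution for $\Delta(p)$, except that the $n_x$ coordinates of $w(0)$ belonging to the shift block are equal to $\xi$ instead of $0$.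 **Theorem.** Assume that $\psi$ is recognizable. Then, for every realization $M$ of $\psi$, every FALPV $\Sigma$ has an LFT $\mathcal M(\Sigma,\psi)$ as above, and for all choices of these LFTs the following hold. 1. For every solution $(x,y,u,p)$ of $\Sigma$ there is a unique solution $(z,y,u)$ of $\mathcal M(\Sigma)$ for $\Delta(p)$ with initial state $x(0)$ such that $z(t)=(x(t+1)^T,\tilde z(t)^T)^T$ for some signal $\tilde z$; that is, there is a unique $\tilde z$ such that, with $w(t)=\Delta_{p(t)}\tilde z(t)$, for all $t\in\mathbb N$, $$x(t+1)=A_0x(t)+\mathcal H_xw(t)+B_0u(t),\quad \tilde z(t)=\mathcal G_xx(t)+\mathcal Fw(t)+\mathcal G_uu(t),\quad y(t)=C_0x(t)+\mathcal H_yw(t)+D_0u(t).$$ In particular, if $x(0)=0$, there is a unique solution $(z,y,u)$ of $\mathcal M(\Sigma)$ for $\Delta(p)$ of this form. 2. Two FALPVs $\Sigma$ and $\hat\Sigma$ are input-output equivalent if and only if $\mathcal M(\Sigma)$ and $\mathcal M(\hat\Sigma)$ are formally input-output equivalent. 3. $\Sigma$ is minimal if and only if $\mathcal M(\Sigma)$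 is minimal. -/

import Mathlib

open Matrix

/-! ### Linear fractional transformation representations (LFTs) -/

/-- An LFT with output coordinates `p`, input coordinates `m` and uncertainty blocks labelled
by `ι`; the block `i` has size `n i` (possibly `0`), and the coordinates of the LFT are the
pairs `⟨i, a⟩` with `a : Fin (n i)`. -/
structure LFT (p m ι : Type) where
  n : ι → ℕ
  A : Matrix (Σ i, Fin (n i)) (Σ i, Fin (n i)) ℝ
  B : Matrix (Σ i, Fin (n i)) m ℝ
  C : Matrix p (Σ i, Fin (n i)) ℝ
  D : Matrix p m ℝ

namespace LFT

variable {p m ι : Type}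

/-- The coordinates of `M`, i.e. those of `ℝⁿ` with `n = ∑ i, n i`. -/
abbrev Coord (M : LFT p m ι) : Type := Σ i, Fin (M.n i)

/-- The block `A_{i,j}` of the canonical partitioning. -/
def blockA (M : LFT p m ι) (i j : ι) : Matrix (Fin (M.n i)) (Fin (M.n j)) ℝ :=
  fun a b => M.A ⟨i, a⟩ ⟨j, b⟩

/-- The block `B_i` of the canonical partitioning. -/
def blockB (M : LFT p m ι) (i : ι) : Matrix (Fin (M.n i)) m ℝ :=
  fun a b => M.B ⟨i, a⟩ b

/-- The block `C_i` of the canonical partitioning. -/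
def blockC (M : LFT p m ι) (i : ι) : Matrix p (Fin (M.n i)) ℝ :=
  fun a b => M.C a ⟨i, b⟩

/-- `propagate M i (i₂ ⋯ iₖ) V = C_{iₖ} A_{iₖ,iₖ₋₁} ⋯ A_{i₂,i} V`, and `C_i V` for the empty
word. -/
def propagate (M : LFT p m ι) : (i : ι) → List ι → Matrix (Fin (M.n i)) m ℝ → Matrix p m ℝ
  | i, [], V => M.blockC i * V
  | i, j :: w, V => M.propagate j w (M.blockA j i * V)

/-- The formal input-output map: `D` on the empty word, and
`C_{iₖ} A_{iₖ,iₖ₋₁} ⋯ A_{i₂,i₁} B_{i₁}` on the word `i₁ i₂ ⋯ iₖ`. -/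
def formalMap (M : LFT p m ι) : List ι → Matrix p m ℝ
  | [] => M.D
  | i :: w => M.propagate i w (M.blockB i)

/-- Formal input-output equivalence. -/
def FormallyEquivalent (M₁ M₂ : LFT p m ι) : Prop := M₁.formalMap = M₂.formalMap

/-- The dimension `∑ i, n i`. -/
def dim [Fintype ι] (M : LFT p m ι) : ℕ := ∑ i, M.n i

/-- Minimality: least dimension among all formally input-output equivalent LFTs (with the same
input, output and block labels). -/
def IsMinimal [Fintype ι] (M : LFT p m ι) : Prop :=
  ∀ M' : LFT p m ι, M'.FormallyEquivalent M → M.dim ≤ M'.dim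

/-- Stability: `Aᵀ P A - P < 0` for some `P = Diag[P_1, …, P_d]` with positive definite `P_i`. -/
def IsStable [Fintype ι] [DecidableEq ι] (M : LFT p m ι) : Prop :=
  ∃ P : ∀ i, Matrix (Fin (M.n i)) (Fin (M.n i)) ℝ,
    (∀ i, (P i).PosDef) ∧
      (Matrix.blockDiagonal' P - M.Aᵀ * Matrix.blockDiagonal' P * M.A).PosDef

/-- The operator `Δ = Diag[δ_1 I, …, δ_d I]` on signals, for linear operators `δ_i` on scalar
signals. -/
def blockOp (M : LFT p m ι) (δ : ι → (ℕ → ℝ) →ₗ[ℝ] (ℕ → ℝ)) (z : ℕ → M.Coord → ℝ) :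
    ℕ → M.Coord → ℝ :=
  fun t s => δ s.1 (fun τ => z τ s) t

/-- Solutions of `M` for `Δ = Diag[δ_i I]` with an initial condition `w₀` of `Δ`:
`z = A w + B u`, `y = C w + D u`, `w = Δ z + w₀`. -/
def IsSolutionFrom [Fintype ι] [Fintype m] (M : LFT p m ι)
    (δ : ι → (ℕ → ℝ) →ₗ[ℝ] (ℕ → ℝ)) (w₀ : ℕ → M.Coord → ℝ)
    (z : ℕ → M.Coord → ℝ) (y : ℕ → p → ℝ) (u : ℕ → m → ℝ) : Prop :=
  ∃ w : ℕ → M.Coord → ℝ, w = M.blockOp δ z + w₀ ∧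
    ∀ t, z t = M.A *ᵥ w t + M.B *ᵥ u t ∧ y t = M.C *ᵥ w t + M.D *ᵥ u t

/-- Solutions of `M` for `Δ = Diag[δ_i I]`: `z = A w + B u`, `y = C w + D u`, `w = Δ z`. -/
def IsSolution [Fintype ι] [Fintype m] (M : LFT p m ι)
    (δ : ι → (ℕ → ℝ) →ₗ[ℝ] (ℕ → ℝ))
    (z : ℕ → M.Coord → ℝ) (y : ℕ → p → ℝ) (u : ℕ → m → ℝ) : Prop :=
  M.IsSolutionFrom δ 0 z y u

/-- The matrix `Δ_𝐩 = Diag[𝐩_1 I, …, 𝐩_d I]`. -/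
def deltaMatrix [DecidableEq ι] (M : LFT p m ι) (q : ι → ℝ) : Matrix M.Coord M.Coord ℝ :=
  Matrix.diagonal fun s => q s.1

end LFT

/-! ### Functional-affine LPV models (FALPVs) -/

/-- The set `ℙ = [-1,1]^{n_p}` of scheduling parameters. -/
abbrev SchedulingSet (np : ℕ) : Set (Fin np → ℝ) := {q | ∀ i, q i ∈ Set.Icc (-1 : ℝ) 1}

/-- The functions `1, ψ_1, …, ψ_{n_ψ}` on `ℙ`. -/
def oneAndComponents {np nψ : ℕ} (ψ : SchedulingSet np → Fin nψ → ℝ) :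
    Fin (nψ + 1) → SchedulingSet np → ℝ :=
  Fin.cons (fun _ => 1) (fun l q => ψ q l)

/-- The constant matrices `A_l, B_l, C_l, D_l`, `l = 0, …, n_ψ`, of an FALPV of dimension
`nx`. -/
structure FALPV (nψ nx nu ny : ℕ) where
  A : Fin (nψ + 1) → Matrix (Fin nx) (Fin nx) ℝ
  B : Fin (nψ + 1) → Matrix (Fin nx) (Fin nu) ℝ
  C : Fin (nψ + 1) → Matrix (Fin ny) (Fin nx) ℝ
  D : Fin (nψ + 1) → Matrix (Fin ny) (Fin nu) ℝ

/-- `X_0 + ∑_l v_l X_l`. -/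
def affineCombination {nψ : ℕ} {a b : Type} (X : Fin (nψ + 1) → Matrix a b ℝ)
    (v : Fin nψ → ℝ) : Matrix a b ℝ :=
  X 0 + ∑ l : Fin nψ, v l • X l.succ

namespace FALPV

variable {np nψ nx nx' nu ny : ℕ}

/-- `(x, y, u, p)` is a solution of the FALPV `S` with respect to `ψ`. -/
def IsSolution (S : FALPV nψ nx nu ny) (ψ : SchedulingSet np → Fin nψ → ℝ)
    (x : ℕ → Fin nx → ℝ) (y : ℕ → Fin ny → ℝ) (u : ℕ → Fin nu → ℝ)
    (p : ℕ → SchedulingSet np) : Prop :=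
  ∀ t, x (t + 1) = affineCombination S.A (ψ (p t)) *ᵥ x t
          + affineCombination S.B (ψ (p t)) *ᵥ u t ∧
    y t = affineCombination S.C (ψ (p t)) *ᵥ x t + affineCombination S.D (ψ (p t)) *ᵥ u t

/-- The state trajectory from the zero initial state. -/
def zeroState (S : FALPV nψ nx nu ny) (ψ : SchedulingSet np → Fin nψ → ℝ)
    (u : ℕ → Fin nu → ℝ) (p : ℕ → SchedulingSet np) : ℕ → Fin nx → ℝ
  | 0 => 0
  | t + 1 => affineCombination S.A (ψ (p t)) *ᵥ zeroState S ψ u p t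
      + affineCombination S.B (ψ (p t)) *ᵥ u t

/-- The input-output map `Y_Σ`. -/
def ioMap (S : FALPV nψ nx nu ny) (ψ : SchedulingSet np → Fin nψ → ℝ)
    (u : ℕ → Fin nu → ℝ) (p : ℕ → SchedulingSet np) : ℕ → Fin ny → ℝ :=
  fun t => affineCombination S.C (ψ (p t)) *ᵥ S.zeroState ψ u p t
    + affineCombination S.D (ψ (p t)) *ᵥ u t

/-- The defining property of the input-output map. -/
theorem eq_ioMap_iff (S : FALPV nψ nx nu ny) (ψ : SchedulingSet np → Fin nψ → ℝ)
    (u : ℕ → Fin nu → ℝ) (p : ℕ → SchedulingSet np) (y : ℕ → Fin ny → ℝ) :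
    y = S.ioMap ψ u p ↔ ∃ x, S.IsSolution ψ x y u p ∧ x 0 = 0 := by
  constructor
  · rintro rfl
    exact ⟨S.zeroState ψ u p, fun t => ⟨rfl, rfl⟩, rfl⟩
  · rintro ⟨x, hx, h0⟩
    have key : ∀ t, x t = S.zeroState ψ u p t := by
      intro t
      induction t with
      | zero => exact h0
      | succ t ih => rw [(hx t).1, ih, zeroState]
    funext t
    rw [(hx t).2, key t, ioMap]

/-- Input-output equivalence of two FALPVs with respect to the same `ψ`. -/
def IOEquivalent (ψ : SchedulingSet np → Fin nψ → ℝ) (S : FALPV nψ nx nu ny)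
    (S' : FALPV nψ nx' nu ny) : Prop :=
  S.ioMap ψ = S'.ioMap ψ

/-- Minimality: least state dimension among all input-output equivalent FALPVs. -/
def IsMinimal (ψ : SchedulingSet np → Fin nψ → ℝ) (S : FALPV nψ nx nu ny) : Prop :=
  ∀ (nx' : ℕ) (S' : FALPV nψ nx' nu ny), IOEquivalent ψ S' S → nx ≤ nx'

end FALPV

/-! ### Recognizable functions and the LFT associated with an FALPV -/

/-- `M = (n_ψ, 1, {n_i}, F, G, H, 0)` is a minimal and stable LFT realization of `ψ`:
`ψ(𝐩) = H Δ_𝐩 (I - F Δ_𝐩)⁻¹ G` on `ℙ`. -/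
structure IsRealization {np nψ : ℕ} (M : LFT (Fin nψ) (Fin 1) (Fin np))
    (ψ : SchedulingSet np → Fin nψ → ℝ) : Prop where
  minimal : M.IsMinimal
  stable : M.IsStable
  D_eq_zero : M.D = 0
  eq : ∀ q : SchedulingSet np, ∀ l : Fin nψ,
    ψ q l = (M.C * M.deltaMatrix q.1 * (1 - M.A * M.deltaMatrix q.1)⁻¹ * M.B) l 0

/-- `ψ` is recognizable. -/
def IsRecognizable {np nψ : ℕ} (ψ : SchedulingSet np → Fin nψ → ℝ) : Prop :=
  ∃ M : LFT (Fin nψ) (Fin 1) (Fin np), IsRealization M ψ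

/-- The backward shift `(λ z)(t) = z(t-1)`, with `(λ z)(0) = 0`. -/
def backwardShift : (ℕ → ℝ) →ₗ[ℝ] (ℕ → ℝ) where
  toFun z t := Nat.casesOn t 0 z
  map_add' z z' := by funext t; cases t <;> simp
  map_smul' c z := by funext t; cases t <;> simp

/-- Element-wise multiplication by the scalar signal `c`. -/
def mulSignal (c : ℕ → ℝ) : (ℕ → ℝ) →ₗ[ℝ] (ℕ → ℝ) where
  toFun z t := c t * z t
  map_add' z z' := by funext t; simp [mul_add]
  map_smul' a z := by funext t; simp [mul_left_comm]

/-- The uncertainty `Δ(p) = Diag[λ I, p_1 I, …, p_{n_p} I]`; the block of the shift is labelled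
`none`, that of `p_i` is labelled `some i`. -/
def schedulingUncertainty {np : ℕ} (p : ℕ → SchedulingSet np) :
    Option (Fin np) → (ℕ → ℝ) →ₗ[ℝ] (ℕ → ℝ)
  | none => backwardShift
  | some i => mulSignal fun t => (p t).1 i

namespace FALPV

variable {np nψ nx nu ny : ℕ}

/-- The map `ν ↦ ∑_{l=1}^{n_ψ} S^l(ν) [A_l B_l; C_l D_l]`, where `S` is the formal input-output
map of the LFT `M`. -/
def seriesMap (S : FALPV nψ nx nu ny) (M : LFT (Fin nψ) (Fin 1) (Fin np)) :
    List (Fin np) → Matrix (Fin nx ⊕ Fin ny) (Fin nx ⊕ Fin nu) ℝ :=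
  fun ν => ∑ l : Fin nψ, M.formalMap ν l 0 •
    Matrix.fromBlocks (S.A l.succ) (S.B l.succ) (S.C l.succ) (S.D l.succ)

/-- `N = (n_x + n_y, n_x + n_u, n_p, {n̄_i}, 𝓕, 𝓖, 𝓗, 0)` is a minimal and stable LFT realization
of `S.seriesMap M`. -/
structure IsSeriesRealization (S : FALPV nψ nx nu ny) (M : LFT (Fin nψ) (Fin 1) (Fin np))
    (N : LFT (Fin nx ⊕ Fin ny) (Fin nx ⊕ Fin nu) (Fin np)) : Prop where
  minimal : N.IsMinimal
  stable : N.IsStable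
  D_eq_zero : N.D = 0
  eq : N.formalMap = S.seriesMap M

/-- The LFT obtained from the FALPV `S` and from `N = (𝓕, 𝓖, 𝓗, 0)`: its matrices are
`A = [A_0 𝓗_x; 𝓖_x 𝓕]`, `B = [B_0; 𝓖_u]`, `C = [C_0 𝓗_y]`, `D = D_0`. -/
def toLFT (S : FALPV nψ nx nu ny) (N : LFT (Fin nx ⊕ Fin ny) (Fin nx ⊕ Fin nu) (Fin np)) :
    LFT (Fin ny) (Fin nu) (Option (Fin np)) where
  n
    | none => nx
    | some i => N.n i
  A
    | ⟨none, a⟩, ⟨none, b⟩ => S.A 0 a b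
    | ⟨none, a⟩, ⟨some j, b⟩ => N.C (Sum.inl a) ⟨j, b⟩
    | ⟨some i, a⟩, ⟨none, b⟩ => N.B ⟨i, a⟩ (Sum.inl b)
    | ⟨some i, a⟩, ⟨some j, b⟩ => N.A ⟨i, a⟩ ⟨j, b⟩
  B
    | ⟨none, a⟩, b => S.B 0 a b
    | ⟨some i, a⟩, b => N.B ⟨i, a⟩ (Sum.inr b)
  C
    | a, ⟨none, b⟩ => S.C 0 a b
    | a, ⟨some j, b⟩ => N.C (Sum.inr a) ⟨j, b⟩
  D := S.D 0

/-- The signal `z = (z₁, z̃)` of `S.toLFT N`. -/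
def joinSignal (S : FALPV nψ nx nu ny)
    (N : LFT (Fin nx ⊕ Fin ny) (Fin nx ⊕ Fin nu) (Fin np))
    (z₁ : ℕ → Fin nx → ℝ) (zt : ℕ → N.Coord → ℝ) : ℕ → (S.toLFT N).Coord → ℝ
  | t, ⟨none, a⟩ => z₁ t a
  | t, ⟨some i, a⟩ => zt t ⟨i, a⟩

/-- The initial condition of `Δ(p)`: the output of the shift block at time `0` is `ξ`. -/
def initialSignal (S : FALPV nψ nx nu ny)
    (N : LFT (Fin nx ⊕ Fin ny) (Fin nx ⊕ Fin nu) (Fin np)) (ξ : Fin nx → ℝ) :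
    ℕ → (S.toLFT N).Coord → ℝ :=
  S.joinSignal N (fun t => if t = 0 then ξ else 0) 0

end FALPV

/-!
The argument is carried by bisimulations: linear relations between the states of two systems that
contain the pairs of input columns, are preserved by the state matrices, and relate only states
with equal outputs. Two LFTs are formally input-output equivalent exactly if a bisimulation
exists (the largest one consists of the indistinguishable states), and the same holds for FALPVs
and input-output equivalence (`FALPV.IOEquivalent.exists_isBisimulation`). In the latter case the
linear independence of `1, ψ_1, …, ψ_{n_ψ}` turns equations between affine combinations of the
constant matrices into equations between the constant matrices.

A word `ν` that leaves the shift block of the associated LFT and returns to it acts as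
`∑_l S^l(ν) A_l`. By `IsRealization.span_range_formalMap_eq_top` the vectors `S(ν)` span `ℝ^{n_ψ}`:
a linear relation between the series `S^l` would be inherited by their transfer functions `ψ_l`.
Hence invariance under the associated LFT amounts, on the shift block, to invariance under all the
constant matrices of the FALPV. This transports bisimulations in both directions, which is the
statement on equivalence. It also transports reachability and observability, both defined through
invariant families of subspaces, from a minimal FALPV to its associated LFT.

For LFTs, a reachable and observable LFT has the smallest possible blocks one by one
(`LFT.n_le_of_reachable_observable`), and a minimal LFT is reachable and observable, since
otherwise a restriction or a quotient is smaller. Blockwise minimality is what makes the shift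
block, that is the FALPV, minimal when the associated LFT is. Restrictions and quotients of a
stable LFT are stable, so that a stable LFT has a minimal and stable equivalent; applied to copies
of the realization of `ψ` (`LFT.tensor`) this gives the existence of the associated LFT.

Stability makes `I - 𝓕 Δ_𝐩` invertible (`LFT.IsStable.isUnit_one_sub`), so `z̃` is determined by
the state and the input, and the transfer function of `N` is `∑_l ψ_l [A_l B_l; C_l D_l]`
(`FALPV.IsSeriesRealization.transfer_mulVec`), which gives the statement on solutions. No power
series are needed: the resolvent `(I - A Δ_𝐩)⁻¹` preserves every invariant relation
(`LFT.resolvent_mem_relation`).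
-/

namespace LFT

variable {p m ι : Type}

/-! ### Words and blocks of LFTs -/

/-- The observation matrix `C_{iₖ} A_{iₖ,iₖ₋₁} ⋯ A_{i₂,i}` of the block `i` along the word
`i₂ ⋯ iₖ`. -/
def obs (M : LFT p m ι) : (i : ι) → List ι → Matrix p (Fin (M.n i)) ℝ
  | i, [] => M.blockC i
  | i, j :: w => M.obs j w * M.blockA j i

theorem propagate_eq_obs_mul (M : LFT p m ι) (i : ι) (w : List ι)
    (V : Matrix (Fin (M.n i)) m ℝ) : M.propagate i w V = M.obs i w * V := by
  induction w generalizing i with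
  | nil => rfl
  | cons j w ih => rw [propagate, ih, obs, Matrix.mul_assoc]

theorem formalMap_cons (M : LFT p m ι) (i : ι) (w : List ι) :
    M.formalMap (i :: w) = M.obs i w * M.blockB i :=
  M.propagate_eq_obs_mul i w _

/-- The part of a vector of coordinates that belongs to the block `i`. -/
def blk (M : LFT p m ι) (z : M.Coord → ℝ) (i : ι) : Fin (M.n i) → ℝ := fun a => z ⟨i, a⟩

theorem blk_add (M : LFT p m ι) (z z' : M.Coord → ℝ) (i : ι) :
    M.blk (z + z') i = M.blk z i + M.blk z' i := rfl

theorem blk_sub (M : LFT p m ι) (z z' : M.Coord → ℝ) (i : ι) :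
    M.blk (z - z') i = M.blk z i - M.blk z' i := rfl

theorem blk_zero (M : LFT p m ι) (i : ι) : M.blk 0 i = 0 := rfl

theorem blk_injective (M : LFT p m ι) : Function.Injective M.blk := by
  intro z z' h
  funext ⟨i, a⟩
  exact congrFun (congrFun h i) a

theorem blk_B_mulVec [Fintype m] (M : LFT p m ι) (u : m → ℝ) (i : ι) :
    M.blk (M.B *ᵥ u) i = M.blockB i *ᵥ u := rfl

theorem blk_A_mulVec [Fintype ι] (M : LFT p m ι) (z : M.Coord → ℝ) (i : ι) :
    M.blk (M.A *ᵥ z) i = ∑ j, M.blockA i j *ᵥ M.blk z j := by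
  funext a
  simp only [blk, mulVec, dotProduct, blockA, Fintype.sum_sigma, Finset.sum_apply]

theorem C_mulVec [Fintype ι] (M : LFT p m ι) (z : M.Coord → ℝ) :
    M.C *ᵥ z = ∑ j, M.blockC j *ᵥ M.blk z j := by
  funext a
  simp only [blk, mulVec, dotProduct, blockC, Fintype.sum_sigma, Finset.sum_apply]

theorem blk_deltaMatrix_mulVec [Fintype ι] [DecidableEq ι] (M : LFT p m ι) (q : ι → ℝ)
    (z : M.Coord → ℝ) (i : ι) : M.blk (M.deltaMatrix q *ᵥ z) i = q i • M.blk z i := by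
  funext a
  simp [blk, deltaMatrix, mulVec_diagonal]

/-! ### Bisimulations and formal equivalence of LFTs -/

/-- A bisimulation between two LFTs: for every block a linear relation between the two state
spaces which contains the pairs of input columns, is preserved by the state matrices, and relates
only states with equal outputs. -/
structure IsBisimulation [Fintype m] (M M' : LFT p m ι)
    (Z : ∀ i, Submodule ℝ ((Fin (M.n i) → ℝ) × (Fin (M'.n i) → ℝ))) : Prop where
  B_mem : ∀ i u, (M.blockB i *ᵥ u, M'.blockB i *ᵥ u) ∈ Z i
  A_mem : ∀ i j, ∀ x ∈ Z i, (M.blockA j i *ᵥ x.1, M'.blockA j i *ᵥ x.2) ∈ Z j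
  C_eq : ∀ i, ∀ x ∈ Z i, M.blockC i *ᵥ x.1 = M'.blockC i *ᵥ x.2
  D_eq : M.D = M'.D

theorem IsBisimulation.obs_eq [Fintype m] {M M' : LFT p m ι}
    {Z : ∀ i, Submodule ℝ ((Fin (M.n i) → ℝ) × (Fin (M'.n i) → ℝ))}
    (h : IsBisimulation M M' Z) (w : List ι) :
    ∀ i, ∀ x ∈ Z i, M.obs i w *ᵥ x.1 = M'.obs i w *ᵥ x.2 := by
  induction w with
  | nil => exact h.C_eq
  | cons j w ih =>
    intro i x hx
    have := ih j _ (h.A_mem i j x hx)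
    simpa [obs, mulVec_mulVec] using this

theorem IsBisimulation.formallyEquivalent [Fintype m] {M M' : LFT p m ι}
    {Z : ∀ i, Submodule ℝ ((Fin (M.n i) → ℝ) × (Fin (M'.n i) → ℝ))}
    (h : IsBisimulation M M' Z) : M.FormallyEquivalent M' := by
  classical
  funext w
  cases w with
  | nil => exact h.D_eq
  | cons i w =>
    rw [formalMap_cons, formalMap_cons]
    refine Matrix.ext_of_mulVec_single fun k => ?_
    rw [← mulVec_mulVec, ← mulVec_mulVec]
    exact h.obs_eq w i _ (h.B_mem i (Pi.single k 1))

/-- States of two LFTs that produce the same outputs along all words. -/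
def indistinguishable (M M' : LFT p m ι) (i : ι) :
    Submodule ℝ ((Fin (M.n i) → ℝ) × (Fin (M'.n i) → ℝ)) where
  carrier := {x | ∀ w, M.obs i w *ᵥ x.1 = M'.obs i w *ᵥ x.2}
  add_mem' := by
    intro a b ha hb w
    simp [mulVec_add, ha w, hb w]
  zero_mem' := by intro w; simp
  smul_mem' := by
    intro c a ha w
    simp [mulVec_smul, ha w]

theorem FormallyEquivalent.isBisimulation [Fintype m] {M M' : LFT p m ι}
    (h : M.FormallyEquivalent M') : IsBisimulation M M' (indistinguishable M M') where
  B_mem i u := by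
    intro w
    have := congrFun h (i :: w)
    rw [formalMap_cons, formalMap_cons] at this
    simp [mulVec_mulVec, this]
  A_mem i j x hx := by
    intro w
    simpa [obs, mulVec_mulVec] using hx (j :: w)
  C_eq i x hx := hx []
  D_eq := congrFun h []

/-- A linear map that intertwines the matrices of two LFTs block by block has a bisimulation as
its graph. -/
theorem formallyEquivalent_of_intertwining [Fintype m] {M M' : LFT p m ι}
    (T : ∀ i, Matrix (Fin (M'.n i)) (Fin (M.n i)) ℝ)
    (hB : ∀ i, T i * M.blockB i = M'.blockB i)
    (hA : ∀ i j, T j * M.blockA j i = M'.blockA j i * T i)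
    (hC : ∀ i, M.blockC i = M'.blockC i * T i) (hD : M.D = M'.D) :
    M.FormallyEquivalent M' := by
  refine IsBisimulation.formallyEquivalent (Z := fun i => (T i).mulVecLin.graph) ⟨?_, ?_, ?_, hD⟩
  · intro i u
    simp [LinearMap.mem_graph_iff, mulVec_mulVec, hB]
  · intro i j x hx
    rw [LinearMap.mem_graph_iff] at hx ⊢
    simp only [mulVecLin_apply] at hx ⊢
    rw [hx, mulVec_mulVec, mulVec_mulVec, hA]
  · intro i x hx
    rw [LinearMap.mem_graph_iff] at hx
    simp only [mulVecLin_apply] at hx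
    rw [hx, mulVec_mulVec, hC]

/-- `(I - A Δ_𝐪)⁻¹ b` stays within every relation between the states of two LFTs that contains
`b` and is preserved by the state matrices, because the injective endomorphism `I - A Δ_𝐪` of the
finite-dimensional relation is onto. -/
theorem resolvent_mem_relation [Fintype ι] [DecidableEq ι] {p' m' : Type}
    (M : LFT p m ι) (M' : LFT p' m' ι) (q : ι → ℝ)
    (hM : IsUnit (1 - M.A * M.deltaMatrix q)) (hM' : IsUnit (1 - M'.A * M'.deltaMatrix q))
    (Z : ∀ i, Submodule ℝ ((Fin (M.n i) → ℝ) × (Fin (M'.n i) → ℝ)))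
    (hA : ∀ i j, ∀ x ∈ Z i, (M.blockA j i *ᵥ x.1, M'.blockA j i *ᵥ x.2) ∈ Z j)
    (b : M.Coord → ℝ) (b' : M'.Coord → ℝ) (hb : ∀ i, (M.blk b i, M'.blk b' i) ∈ Z i) (i : ι) :
    (M.blk ((1 - M.A * M.deltaMatrix q)⁻¹ *ᵥ b) i,
      M'.blk ((1 - M'.A * M'.deltaMatrix q)⁻¹ *ᵥ b') i) ∈ Z i := by
  let V : Submodule ℝ ((M.Coord → ℝ) × (M'.Coord → ℝ)) :=
    { carrier := {x | ∀ i, (M.blk x.1 i, M'.blk x.2 i) ∈ Z i}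
      add_mem' := fun {x y} hx hy i => (Z i).add_mem (hx i) (hy i)
      zero_mem' := fun i => (Z i).zero_mem
      smul_mem' := fun c x hx i => (Z i).smul_mem c (hx i) }
  let T : ((M.Coord → ℝ) × (M'.Coord → ℝ)) →ₗ[ℝ] ((M.Coord → ℝ) × (M'.Coord → ℝ)) :=
    (1 - M.A * M.deltaMatrix q).mulVecLin.prodMap (1 - M'.A * M'.deltaMatrix q).mulVecLin
  have hTV : ∀ x ∈ V, T x ∈ V := by
    intro x hx i
    have key : (M.blk (M.A *ᵥ (M.deltaMatrix q *ᵥ x.1)) i,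
        M'.blk (M'.A *ᵥ (M'.deltaMatrix q *ᵥ x.2)) i) ∈ Z i := by
      have : (M.blk (M.A *ᵥ (M.deltaMatrix q *ᵥ x.1)) i,
          M'.blk (M'.A *ᵥ (M'.deltaMatrix q *ᵥ x.2)) i) =
          ∑ j, q j • (M.blockA i j *ᵥ M.blk x.1 j, M'.blockA i j *ᵥ M'.blk x.2 j) := by
        ext1
        · simp only [Prod.fst_sum, Prod.smul_fst, blk_A_mulVec, blk_deltaMatrix_mulVec,
            mulVec_smul]
        · simp only [Prod.snd_sum, Prod.smul_snd, blk_A_mulVec, blk_deltaMatrix_mulVec,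
            mulVec_smul]
      rw [this]
      exact (Z i).sum_mem fun j _ => (Z i).smul_mem _ (hA j i _ (hx j))
    have := (Z i).sub_mem (hx i) key
    simpa [T, sub_mulVec, mulVec_mulVec, blk_sub] using this
  have hTinj : Function.Injective T := by
    intro x y hxy
    have h1 := congrArg Prod.fst hxy
    have h2 := congrArg Prod.snd hxy
    simp only [T, LinearMap.prodMap_apply, mulVecLin_apply] at h1 h2
    exact Prod.ext (mulVec_injective_of_isUnit hM h1) (mulVec_injective_of_isUnit hM' h2)
  have hsurj : Function.Surjective (T.restrict hTV) :=
    LinearMap.surjective_of_injective fun x y hxy =>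
      Subtype.ext (hTinj (congrArg Subtype.val hxy))
  obtain ⟨x, hx⟩ := hsurj ⟨(b, b'), hb⟩
  have hx' : T x.1 = (b, b') := congrArg Subtype.val hx
  have h1 := congrArg Prod.fst hx'
  have h2 := congrArg Prod.snd hx'
  simp only [T, LinearMap.prodMap_apply, mulVecLin_apply] at h1 h2
  rw [isUnit_iff_isUnit_det] at hM hM'
  rw [← h1, ← h2, mulVec_mulVec, mulVec_mulVec, nonsing_inv_mul _ hM, nonsing_inv_mul _ hM',
    one_mulVec, one_mulVec]
  exact x.2 i

/-! ### Reachability, observability and minimality of LFTs -/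

/-- Reachability: no proper family of subspaces contains the input columns and is preserved by
the state matrices. -/
def IsReachable [Fintype m] (M : LFT p m ι) : Prop :=
  ∀ W : ∀ i, Submodule ℝ (Fin (M.n i) → ℝ), (∀ i u, M.blockB i *ᵥ u ∈ W i) →
    (∀ i j, ∀ x ∈ W i, M.blockA j i *ᵥ x ∈ W j) → ∀ i, W i = ⊤

/-- Observability: no nonzero family of subspaces is annihilated by the output matrices and
preserved by the state matrices. -/
def IsObservable (M : LFT p m ι) : Prop :=
  ∀ U : ∀ i, Submodule ℝ (Fin (M.n i) → ℝ), (∀ i, ∀ x ∈ U i, M.blockC i *ᵥ x = 0) →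
    (∀ i j, ∀ x ∈ U i, M.blockA j i *ᵥ x ∈ U j) → ∀ i, U i = ⊥

/-- Each block of a reachable and observable LFT is the smallest possible one: by reachability
every state is indistinguishable from some state of the equivalent LFT, and by observability
from a nonzero one if it is nonzero. -/
theorem n_le_of_reachable_observable [Fintype m] {M M' : LFT p m ι} (hr : M.IsReachable)
    (ho : M.IsObservable) (h : M.FormallyEquivalent M') (i : ι) : M.n i ≤ M'.n i := by
  have hZ := h.isBisimulation
  set Z := indistinguishable M M'
  have hfst : (Z i).map (LinearMap.fst ℝ _ _) = ⊤ := by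
    refine hr (fun i => (Z i).map (LinearMap.fst ℝ _ _)) ?_ ?_ i
    · intro i u
      exact ⟨_, hZ.B_mem i u, rfl⟩
    · rintro i j _ ⟨x, hx, rfl⟩
      exact ⟨_, hZ.A_mem i j x hx, rfl⟩
  have hker : ∀ x ∈ Z i, x.2 = 0 → x.1 = 0 := by
    have := ho (fun i => (Z i).comap (LinearMap.inl ℝ _ _)) ?_ ?_ i
    · intro x hx h2
      have hx1 : x.1 ∈ (Z i).comap (LinearMap.inl ℝ _ _) := by
        have : x = (x.1, 0) := Prod.ext rfl h2
        rw [this] at hx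
        exact hx
      rwa [this] at hx1
    · intro i x hx
      simpa using hZ.C_eq i _ hx
    · intro i j x hx
      simpa using hZ.A_mem i j _ hx
  have h1 : M.n i ≤ Module.finrank ℝ (Z i) := by
    have := Submodule.finrank_map_le (LinearMap.fst ℝ _ _) (Z i)
    rw [hfst] at this
    simpa using this
  have h2 : Module.finrank ℝ (Z i) ≤ M'.n i := by
    have hinj : Function.Injective ((LinearMap.snd ℝ _ _).comp (Z i).subtype) := by
      rw [← LinearMap.ker_eq_bot, LinearMap.ker_eq_bot']
      intro x hx
      exact Subtype.ext (Prod.ext (hker x.1 x.2 hx) hx)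
    simpa using LinearMap.finrank_le_finrank_of_injective hinj
  exact h1.trans h2

theorem isMinimal_of_reachable_observable [Fintype ι] [Fintype m] {M : LFT p m ι}
    (hr : M.IsReachable) (ho : M.IsObservable) : M.IsMinimal := fun _ h =>
  Finset.sum_le_sum fun i _ => n_le_of_reachable_observable hr ho h.symm i

end LFT

/-! ### Coordinates on subspaces and quotients -/

/-- Coordinates on a subspace: the columns of `J` are a basis, and `L` reads off coefficients. -/
theorem exists_subspace_matrix {n : ℕ} (W : Submodule ℝ (Fin n → ℝ)) :
    ∃ (J : Matrix (Fin n) (Fin (Module.finrank ℝ W)) ℝ)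
      (L : Matrix (Fin (Module.finrank ℝ W)) (Fin n) ℝ),
      L * J = 1 ∧ (∀ z, J *ᵥ z ∈ W) ∧ ∀ x ∈ W, J *ᵥ (L *ᵥ x) = x := by
  let b := (Module.finBasis ℝ W).equivFun
  obtain ⟨π, hπ⟩ := W.subtype.exists_leftInverse_of_injective W.ker_subtype
  have hπ' : ∀ x : W, π x = x := fun x => LinearMap.congr_fun hπ x
  refine ⟨LinearMap.toMatrix' (W.subtype ∘ₗ b.symm.toLinearMap),
    LinearMap.toMatrix' (b.toLinearMap ∘ₗ π), ?_, fun z => ?_, ?_⟩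
  · rw [← LinearMap.toMatrix'_comp, ← LinearMap.toMatrix'_id]
    congr 1
    ext1 x
    ext1
    simp [hπ']
  · simp [LinearMap.toMatrix'_mulVec]
  · intro x hx
    have := hπ' ⟨x, hx⟩
    simp only at this
    simp [LinearMap.toMatrix'_mulVec, this]

/-- Coordinates on a quotient: `Q` is the quotient map, and `J` is a linear section of it. -/
theorem exists_quotient_matrix {n : ℕ} (U : Submodule ℝ (Fin n → ℝ)) :
    ∃ (Q : Matrix (Fin (Module.finrank ℝ ((Fin n → ℝ) ⧸ U))) (Fin n) ℝ)
      (J : Matrix (Fin n) (Fin (Module.finrank ℝ ((Fin n → ℝ) ⧸ U))) ℝ),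
      Q * J = 1 ∧ ∀ x, Q *ᵥ x = 0 ↔ x ∈ U := by
  let b := (Module.finBasis ℝ ((Fin n → ℝ) ⧸ U)).equivFun
  obtain ⟨σ, hσ⟩ := U.mkQ.exists_rightInverse_of_surjective U.range_mkQ
  have hσ' : ∀ x, U.mkQ (σ x) = x := fun x => LinearMap.congr_fun hσ x
  refine ⟨LinearMap.toMatrix' (b.toLinearMap ∘ₗ U.mkQ),
    LinearMap.toMatrix' (σ ∘ₗ b.symm.toLinearMap), ?_, ?_⟩
  · rw [← LinearMap.toMatrix'_comp, ← LinearMap.toMatrix'_id]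
    congr 1
    ext1 x
    ext1
    simp only [LinearMap.comp_apply, hσ', LinearEquiv.coe_coe, LinearEquiv.apply_symm_apply,
      LinearMap.id_apply]
  · intro x
    rw [LinearMap.toMatrix'_mulVec, LinearMap.comp_apply, LinearEquiv.coe_coe,
      LinearEquiv.map_eq_zero_iff]
    simp

/-- A positive definite form descends to the quotient by the kernel of `Q`: the quotient form
takes the minimum over the fibres, which is attained on the image of the section `J`. -/
theorem exists_posDef_quotient {n k : ℕ} {P : Matrix (Fin n) (Fin n) ℝ} (hP : P.PosDef)
    {Q : Matrix (Fin k) (Fin n) ℝ} {J₀ : Matrix (Fin n) (Fin k) ℝ} (hQ : Q * J₀ = 1) :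
    ∃ (P' : Matrix (Fin k) (Fin k) ℝ) (J : Matrix (Fin n) (Fin k) ℝ), P'.PosDef ∧ Q * J = 1 ∧
      (∀ z, J *ᵥ z ⬝ᵥ P *ᵥ (J *ᵥ z) = z ⬝ᵥ P' *ᵥ z) ∧
      ∀ x, Q *ᵥ x ⬝ᵥ P' *ᵥ (Q *ᵥ x) ≤ x ⬝ᵥ P *ᵥ x := by
  have hinj : Function.Injective (Q.vecMul) := by
    intro x y hxy
    have := congrArg (fun v => v ᵥ* J₀) hxy
    simpa [vecMul_vecMul, hQ] using this
  have hG : (Q * P⁻¹ * Qᵀ).PosDef := by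
    simpa using hP.inv.mul_mul_conjTranspose_same hinj
  set P' := (Q * P⁻¹ * Qᵀ)⁻¹ with hP'
  have hdP : IsUnit P.det := (isUnit_iff_isUnit_det _).1 hP.isUnit
  have hdG : IsUnit (Q * P⁻¹ * Qᵀ).det := (isUnit_iff_isUnit_det _).1 hG.isUnit
  have hPJ : P * (P⁻¹ * Qᵀ * P') = Qᵀ * P' := by
    rw [← Matrix.mul_assoc, ← Matrix.mul_assoc, mul_nonsing_inv _ hdP, Matrix.one_mul]
  have hQJ : Q * (P⁻¹ * Qᵀ * P') = 1 := by
    rw [← Matrix.mul_assoc, ← Matrix.mul_assoc, hP', mul_nonsing_inv _ hdG]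
  set J := P⁻¹ * Qᵀ * P' with hJ
  -- vectors are orthogonal to the image of `J` exactly if `Q` annihilates them
  have horth : ∀ y z, y ⬝ᵥ P *ᵥ (J *ᵥ z) = Q *ᵥ y ⬝ᵥ P' *ᵥ z := by
    intro y z
    rw [mulVec_mulVec, hPJ, ← mulVec_mulVec, dotProduct_mulVec, vecMul_transpose]
  have hform : ∀ z, J *ᵥ z ⬝ᵥ P *ᵥ (J *ᵥ z) = z ⬝ᵥ P' *ᵥ z := by
    intro z
    rw [horth, mulVec_mulVec, hQJ, one_mulVec]
  refine ⟨P', J, hG.inv, hQJ, hform, fun x => ?_⟩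
  set y := x - J *ᵥ (Q *ᵥ x) with hy
  have hQy : Q *ᵥ y = 0 := by
    rw [hy, mulVec_sub, mulVec_mulVec _ Q, hQJ, one_mulVec, sub_self]
  have hx : x = y + J *ᵥ (Q *ᵥ x) := by rw [hy, sub_add_cancel]
  have hsymm : J *ᵥ (Q *ᵥ x) ⬝ᵥ P *ᵥ y = y ⬝ᵥ P *ᵥ (J *ᵥ (Q *ᵥ x)) := by
    have hPt : Pᵀ = P := by simpa using hP.isHermitian.eq
    rw [dotProduct_mulVec, dotProduct_comm, ← mulVec_transpose, hPt]
  have hpos : 0 ≤ y ⬝ᵥ P *ᵥ y := by simpa using hP.posSemidef.dotProduct_mulVec_nonneg y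
  have hexp : x ⬝ᵥ P *ᵥ x = y ⬝ᵥ P *ᵥ y + Q *ᵥ x ⬝ᵥ P' *ᵥ (Q *ᵥ x) := by
    conv_lhs => rw [hx]
    rw [mulVec_add, add_dotProduct, dotProduct_add, dotProduct_add, hsymm, horth y, hQy, hform]
    simp
  rw [hexp]
  linarith

namespace LFT

variable {p m ι : Type}

/-! ### Stability -/

theorem dotProduct_blockDiagonal'_mulVec [Fintype ι] [DecidableEq ι] (M : LFT p m ι)
    (P : ∀ i, Matrix (Fin (M.n i)) (Fin (M.n i)) ℝ) (z : M.Coord → ℝ) :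
    z ⬝ᵥ Matrix.blockDiagonal' P *ᵥ z = ∑ i, M.blk z i ⬝ᵥ P i *ᵥ M.blk z i := by
  have hrow : ∀ i a, (Matrix.blockDiagonal' P *ᵥ z) ⟨i, a⟩ = (P i *ᵥ M.blk z i) a := by
    intro i a
    simp only [mulVec, dotProduct, Fintype.sum_sigma]
    rw [Finset.sum_eq_single i]
    · simp [blockDiagonal'_apply_eq, blk]
    · intro j _ hj
      simp [blockDiagonal'_apply_ne _ _ _ hj.symm]
    · simp
  simp only [dotProduct, Fintype.sum_sigma, hrow, blk]

/-- Stability as a strict decrease of the quadratic form of `Diag[P_1, …, P_d]`. -/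
theorem isStable_iff [Fintype ι] [DecidableEq ι] (M : LFT p m ι) :
    M.IsStable ↔ ∃ P : ∀ i, Matrix (Fin (M.n i)) (Fin (M.n i)) ℝ, (∀ i, (P i).PosDef) ∧
      ∀ z : M.Coord → ℝ, z ≠ 0 →
        ∑ i, M.blk (M.A *ᵥ z) i ⬝ᵥ P i *ᵥ M.blk (M.A *ᵥ z) i <
          ∑ i, M.blk z i ⬝ᵥ P i *ᵥ M.blk z i := by
  refine exists_congr fun P => and_congr_right fun hP => ?_
  have hquad : ∀ z : M.Coord → ℝ,
      star z ⬝ᵥ (Matrix.blockDiagonal' P - M.Aᵀ * Matrix.blockDiagonal' P * M.A) *ᵥ z =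
        ∑ i, M.blk z i ⬝ᵥ P i *ᵥ M.blk z i -
          ∑ i, M.blk (M.A *ᵥ z) i ⬝ᵥ P i *ᵥ M.blk (M.A *ᵥ z) i := by
    intro z
    rw [← dotProduct_blockDiagonal'_mulVec, ← dotProduct_blockDiagonal'_mulVec, star_trivial,
      sub_mulVec, dotProduct_sub, ← mulVec_mulVec, ← mulVec_mulVec, dotProduct_mulVec z M.Aᵀ,
      vecMul_transpose]
  have hsymm : (Matrix.blockDiagonal' P)ᵀ = Matrix.blockDiagonal' P := by
    rw [blockDiagonal'_transpose]
    congr 1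
    funext i
    simpa using (hP i).isHermitian.eq
  rw [posDef_iff_dotProduct_mulVec]
  constructor
  · rintro ⟨-, h⟩ z hz
    have := h hz
    rw [hquad] at this
    linarith
  · intro h
    refine ⟨?_, fun z hz => ?_⟩
    · rw [IsHermitian, conjTranspose_eq_transpose_of_trivial]
      simp [transpose_mul, hsymm, Matrix.mul_assoc]
    · rw [hquad]
      linarith [h z hz]

/-- The quadratic form of `Diag[P_1, …, P_d]` decreases under `A Δ_𝐪` if `𝐪 ∈ [-1,1]^d`, so that
`A Δ_𝐪` fixes no nonzero vector. -/
theorem IsStable.isUnit_one_sub [Fintype ι] [DecidableEq ι] {M : LFT p m ι} (h : M.IsStable)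
    {q : ι → ℝ} (hq : ∀ i, q i ∈ Set.Icc (-1 : ℝ) 1) : IsUnit (1 - M.A * M.deltaMatrix q) := by
  obtain ⟨P, hP, hlt⟩ := M.isStable_iff.1 h
  refine (mulVec_injective_iff_isUnit).1 ?_
  refine (LinearMap.ker_eq_bot (f := (1 - M.A * M.deltaMatrix q).mulVecLin)).1 ?_
  rw [LinearMap.ker_eq_bot']
  intro z hz
  have hz' : z = M.A *ᵥ (M.deltaMatrix q *ᵥ z) := by
    simpa [sub_mulVec, sub_eq_zero, mulVec_mulVec] using hz
  by_contra hne
  have hw : M.deltaMatrix q *ᵥ z ≠ 0 := by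
    intro h0
    rw [h0, mulVec_zero] at hz'
    exact hne hz'
  have h1 := hlt _ hw
  rw [← hz'] at h1
  refine absurd h1 (not_lt.2 (Finset.sum_le_sum fun i _ => ?_))
  rw [blk_deltaMatrix_mulVec, mulVec_smul, dotProduct_smul, smul_dotProduct, smul_eq_mul,
    smul_eq_mul, ← mul_assoc]
  have hpos : 0 ≤ M.blk z i ⬝ᵥ P i *ᵥ M.blk z i := by
    simpa using (hP i).posSemidef.dotProduct_mulVec_nonneg (M.blk z i)
  have hq1 : q i * q i ≤ 1 := by
    have := abs_le.2 (hq i)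
    nlinarith [abs_mul_abs_self (q i), abs_nonneg (q i)]
  exact mul_le_of_le_one_left hpos hq1

theorem blk_A_mulVec_of_intertwining [Fintype ι] {M M' : LFT p m ι}
    (T : ∀ i, Matrix (Fin (M'.n i)) (Fin (M.n i)) ℝ)
    (hA : ∀ i j, T j * M.blockA j i = M'.blockA j i * T i) {z : M.Coord → ℝ}
    {z' : M'.Coord → ℝ} (h : ∀ i, M'.blk z' i = T i *ᵥ M.blk z i) (i : ι) :
    M'.blk (M'.A *ᵥ z') i = T i *ᵥ M.blk (M.A *ᵥ z) i := by
  rw [blk_A_mulVec, blk_A_mulVec, mulVec_sum]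
  refine Finset.sum_congr rfl fun j _ => ?_
  rw [h, mulVec_mulVec, mulVec_mulVec, hA]

/-- The block vector with the blocks `v i`. -/
def ofBlk (M : LFT p m ι) (v : ∀ i, Fin (M.n i) → ℝ) : M.Coord → ℝ := fun s => v s.1 s.2

theorem blk_ofBlk (M : LFT p m ι) (v : ∀ i, Fin (M.n i) → ℝ) (i : ι) :
    M.blk (M.ofBlk v) i = v i := rfl

/-- Stability passes to invariant subspaces. -/
theorem IsStable.of_intertwining_injective [Fintype ι] [DecidableEq ι] {M M' : LFT p m ι}
    (h : M'.IsStable) (T : ∀ i, Matrix (Fin (M'.n i)) (Fin (M.n i)) ℝ)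
    (hA : ∀ i j, T j * M.blockA j i = M'.blockA j i * T i)
    (L : ∀ i, Matrix (Fin (M.n i)) (Fin (M'.n i)) ℝ) (hL : ∀ i, L i * T i = 1) :
    M.IsStable := by
  obtain ⟨P, hP, hlt⟩ := M'.isStable_iff.1 h
  have hinj : ∀ i, Function.Injective (T i).mulVec := by
    intro i x y hxy
    have := congrArg (fun v => L i *ᵥ v) hxy
    simpa [mulVec_mulVec, hL] using this
  have hform : ∀ i x, x ⬝ᵥ ((T i)ᵀ * P i * T i) *ᵥ x = T i *ᵥ x ⬝ᵥ P i *ᵥ (T i *ᵥ x) := by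
    intro i x
    rw [← mulVec_mulVec, ← mulVec_mulVec, dotProduct_mulVec x (T i)ᵀ, vecMul_transpose]
  refine M.isStable_iff.2 ⟨fun i => (T i)ᵀ * P i * T i, fun i => ?_, fun z hz => ?_⟩
  · simpa using (hP i).conjTranspose_mul_mul_same (hinj i)
  · set z' := M'.ofBlk fun i => T i *ᵥ M.blk z i with hz'
    have hz0 : z' ≠ 0 := by
      intro h0
      refine hz (M.blk_injective (funext fun i => hinj i ?_))
      have : M'.blk z' i = 0 := by rw [h0, blk_zero]
      rw [hz', blk_ofBlk] at this
      simpa [blk_zero] using this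
    have := hlt z' hz0
    have hAz : ∀ i, M'.blk (M'.A *ᵥ z') i = T i *ᵥ M.blk (M.A *ᵥ z) i :=
      blk_A_mulVec_of_intertwining T hA fun i => rfl
    simp only [hAz] at this
    simpa only [hform, hz', blk_ofBlk] using this

/-- Stability passes to quotients by invariant subspaces. -/
theorem IsStable.of_intertwining_surjective [Fintype ι] [DecidableEq ι] {M M' : LFT p m ι}
    (h : M.IsStable) (T : ∀ i, Matrix (Fin (M'.n i)) (Fin (M.n i)) ℝ)
    (hA : ∀ i j, T j * M.blockA j i = M'.blockA j i * T i)
    (J₀ : ∀ i, Matrix (Fin (M.n i)) (Fin (M'.n i)) ℝ) (hJ₀ : ∀ i, T i * J₀ i = 1) :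
    M'.IsStable := by
  obtain ⟨P, hP, hlt⟩ := M.isStable_iff.1 h
  choose P' J hP' hJ hform hle using fun i => exists_posDef_quotient (hP i) (hJ₀ i)
  refine M'.isStable_iff.2 ⟨P', hP', fun z' hz' => ?_⟩
  set z := M.ofBlk fun i => J i *ᵥ M'.blk z' i with hz
  have hTz : ∀ i, M'.blk z' i = T i *ᵥ M.blk z i := by
    intro i
    rw [hz, blk_ofBlk, mulVec_mulVec, hJ, one_mulVec]
  have hz0 : z ≠ 0 := by
    intro h0
    refine hz' (M'.blk_injective (funext fun i => ?_))
    rw [hTz, h0, blk_zero, mulVec_zero, blk_zero]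
  calc ∑ i, M'.blk (M'.A *ᵥ z') i ⬝ᵥ P' i *ᵥ M'.blk (M'.A *ᵥ z') i
      ≤ ∑ i, M.blk (M.A *ᵥ z) i ⬝ᵥ P i *ᵥ M.blk (M.A *ᵥ z) i := by
        refine Finset.sum_le_sum fun i _ => ?_
        rw [blk_A_mulVec_of_intertwining T hA hTz]
        exact hle i _
    _ < ∑ i, M.blk z i ⬝ᵥ P i *ᵥ M.blk z i := hlt z hz0
    _ = ∑ i, M'.blk z' i ⬝ᵥ P' i *ᵥ M'.blk z' i := by
        refine Finset.sum_congr rfl fun i _ => ?_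
        rw [hz, blk_ofBlk, hform]

/-! ### Reduction to reachable and observable LFTs -/

/-- The LFT with prescribed blocks. -/
def ofBlocks (n : ι → ℕ) (A : ∀ i j, Matrix (Fin (n i)) (Fin (n j)) ℝ)
    (B : ∀ i, Matrix (Fin (n i)) m ℝ) (C : ∀ i, Matrix p (Fin (n i)) ℝ) (D : Matrix p m ℝ) :
    LFT p m ι where
  n := n
  A s t := A s.1 t.1 s.2 t.2
  B s k := B s.1 s.2 k
  C k s := C s.1 k s.2
  D := D

/-- Restriction of an LFT to invariant subspaces that contain the input columns. -/
theorem exists_restriction [Fintype ι] [DecidableEq ι] [Fintype m] (M : LFT p m ι)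
    (W : ∀ i, Submodule ℝ (Fin (M.n i) → ℝ)) (hB : ∀ i u, M.blockB i *ᵥ u ∈ W i)
    (hA : ∀ i j, ∀ x ∈ W i, M.blockA j i *ᵥ x ∈ W j) :
    ∃ M' : LFT p m ι, (∀ i, M'.n i = Module.finrank ℝ (W i)) ∧ M'.FormallyEquivalent M ∧
      (M.IsStable → M'.IsStable) := by
  choose J L hLJ hJ hJL using fun i => exists_subspace_matrix (W i)
  let M' : LFT p m ι := ofBlocks (fun i => Module.finrank ℝ (W i))
    (fun i j => L i * M.blockA i j * J j) (fun i => L i * M.blockB i)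
    (fun i => M.blockC i * J i) M.D
  let T : ∀ i, Matrix (Fin (M.n i)) (Fin (M'.n i)) ℝ := J
  have hJLX : ∀ {κ : Type} [Fintype κ] (i) (X : Matrix (Fin (M.n i)) κ ℝ),
      (∀ u, X *ᵥ u ∈ W i) → J i * (L i * X) = X := by
    classical
    intro κ _ i X hX
    refine Matrix.ext_of_mulVec_single fun k => ?_
    rw [← mulVec_mulVec, ← mulVec_mulVec]
    exact hJL i _ (hX _)
  have hA' : ∀ i j, T j * M'.blockA j i = M.blockA j i * T i := by
    intro i j
    change J j * (L j * M.blockA j i * J i) = M.blockA j i * J i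
    rw [Matrix.mul_assoc (L j)]
    refine hJLX j _ fun u => ?_
    rw [← mulVec_mulVec]
    exact hA i j _ (hJ i u)
  exact ⟨M', fun i => rfl, formallyEquivalent_of_intertwining T (fun i => hJLX i _ (hB i)) hA'
    (fun i => rfl) rfl, fun h => h.of_intertwining_injective T hA' L hLJ⟩

/-- Quotient of an LFT by invariant subspaces that the output matrices annihilate. -/
theorem exists_quotient [Fintype ι] [DecidableEq ι] [Fintype m] (M : LFT p m ι)
    (U : ∀ i, Submodule ℝ (Fin (M.n i) → ℝ)) (hC : ∀ i, ∀ x ∈ U i, M.blockC i *ᵥ x = 0)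
    (hA : ∀ i j, ∀ x ∈ U i, M.blockA j i *ᵥ x ∈ U j) :
    ∃ M' : LFT p m ι, (∀ i, M'.n i = Module.finrank ℝ ((Fin (M.n i) → ℝ) ⧸ U i)) ∧
      M'.FormallyEquivalent M ∧ (M.IsStable → M'.IsStable) := by
  choose Q J hQJ hQ using fun i => exists_quotient_matrix (U i)
  have hU : ∀ i x, x - J i *ᵥ (Q i *ᵥ x) ∈ U i := by
    intro i x
    rw [← hQ, mulVec_sub, mulVec_mulVec _ (Q i), hQJ, one_mulVec, sub_self]
  let M' : LFT p m ι := ofBlocks (fun i => Module.finrank ℝ ((Fin (M.n i) → ℝ) ⧸ U i))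
    (fun i j => Q i * M.blockA i j * J j) (fun i => Q i * M.blockB i)
    (fun i => M.blockC i * J i) M.D
  let T : ∀ i, Matrix (Fin (M'.n i)) (Fin (M.n i)) ℝ := Q
  have hXJQ : ∀ {κ : Type} (i) (X : Matrix κ (Fin (M.n i)) ℝ),
      (∀ x ∈ U i, X *ᵥ x = 0) → X = X * J i * Q i := by
    intro κ i X hX
    refine Matrix.ext_of_mulVec_single fun k => ?_
    have := hX _ (hU i (Pi.single k 1))
    rw [mulVec_sub, sub_eq_zero] at this
    rw [← mulVec_mulVec, ← mulVec_mulVec]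
    exact this
  have hA' : ∀ i j, T j * M.blockA j i = M'.blockA j i * T i := by
    intro i j
    refine hXJQ i (Q j * M.blockA j i) fun x hx => ?_
    rw [← mulVec_mulVec, hQ]
    exact hA i j x hx
  exact ⟨M', fun i => rfl,
    (formallyEquivalent_of_intertwining T (fun i => rfl) hA' (fun i => hXJQ i _ (hC i)) rfl :
      M.FormallyEquivalent M').symm,
    fun h => h.of_intertwining_surjective T hA' J hQJ⟩

/-- The hypothesis holds both for minimal LFTs and for stable LFTs of least dimension among the
stable ones; a proper invariant family of subspaces would give a smaller LFT by restriction. -/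
theorem isReachable_of_dim_le [Fintype ι] [DecidableEq ι] [Fintype m] {M : LFT p m ι}
    (h : ∀ M' : LFT p m ι, M'.FormallyEquivalent M → (M.IsStable → M'.IsStable) →
      M.dim ≤ M'.dim) : M.IsReachable := by
  intro W hB hA
  obtain ⟨M', hn, he, hs⟩ := M.exists_restriction W hB hA
  have hle : ∀ i, M'.n i ≤ M.n i := fun i => by
    rw [hn]
    simpa using Submodule.finrank_le (W i)
  intro i
  have hi := (Finset.sum_eq_sum_iff_of_le fun i _ => hle i).1
    ((Finset.sum_le_sum fun i _ => hle i).antisymm (h M' he hs)) i (Finset.mem_univ i)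
  exact Submodule.eq_top_of_finrank_eq (by rw [← hn, hi]; simp)

theorem isObservable_of_dim_le [Fintype ι] [DecidableEq ι] [Fintype m] {M : LFT p m ι}
    (h : ∀ M' : LFT p m ι, M'.FormallyEquivalent M → (M.IsStable → M'.IsStable) →
      M.dim ≤ M'.dim) : M.IsObservable := by
  intro U hC hA
  obtain ⟨M', hn, he, hs⟩ := M.exists_quotient U hC hA
  have hsum : ∀ i, M'.n i + Module.finrank ℝ (U i) = M.n i := fun i => by
    rw [hn]
    simpa using Submodule.finrank_quotient_add_finrank (U i)
  have hle : ∀ i, M'.n i ≤ M.n i := fun i => by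
    have := hsum i
    omega
  intro i
  have hi := (Finset.sum_eq_sum_iff_of_le fun i _ => hle i).1
    ((Finset.sum_le_sum fun i _ => hle i).antisymm (h M' he hs)) i (Finset.mem_univ i)
  have := hsum i
  exact Submodule.finrank_eq_zero.1 (by omega)

theorem IsMinimal.isReachable [Fintype ι] [DecidableEq ι] [Fintype m] {M : LFT p m ι}
    (h : M.IsMinimal) : M.IsReachable := isReachable_of_dim_le fun M' he _ => h M' he

theorem IsMinimal.isObservable [Fintype ι] [DecidableEq ι] [Fintype m] {M : LFT p m ι}
    (h : M.IsMinimal) : M.IsObservable := isObservable_of_dim_le fun M' he _ => h M' he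

/-- A stable LFT has a minimal and stable equivalent: a stable one of least dimension among the
stable ones is reachable and observable, since restrictions and quotients are stable. -/
theorem IsStable.exists_isMinimal [Fintype ι] [DecidableEq ι] [Fintype m] {M : LFT p m ι}
    (h : M.IsStable) :
    ∃ M' : LFT p m ι, M'.FormallyEquivalent M ∧ M'.IsMinimal ∧ M'.IsStable := by
  classical
  have hex : ∃ k, ∃ M' : LFT p m ι, M'.FormallyEquivalent M ∧ M'.IsStable ∧ M'.dim = k :=
    ⟨_, M, rfl, h, rfl⟩
  obtain ⟨M', he, hs, hdim⟩ := Nat.find_spec hex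
  have hmin : ∀ N : LFT p m ι, N.FormallyEquivalent M' → (M'.IsStable → N.IsStable) →
      M'.dim ≤ N.dim := fun N hN hsN =>
    hdim.le.trans (Nat.find_min' hex ⟨N, hN.trans he, hsN hs, rfl⟩)
  exact ⟨M', he, isMinimal_of_reachable_observable (isReachable_of_dim_le hmin)
    (isObservable_of_dim_le hmin), hs⟩

end LFT

/-! ### Spanning families of coefficient vectors -/

theorem span_range_eq_top_of_forall_sum_mul_eq_zero {k : ℕ} {α : Type*} {v : α → Fin k → ℝ}
    (h : ∀ c : Fin k → ℝ, (∀ q, ∑ l, c l * v q l = 0) → c = 0) :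
    Submodule.span ℝ (Set.range v) = ⊤ := by
  by_contra hne
  obtain ⟨f, hf, hle⟩ := Submodule.exists_le_ker_of_lt_top _ (lt_top_iff_ne_top.2 hne)
  have hrep : ∀ x, f x = ∑ l, f (Pi.single l 1) * x l := by
    intro x
    conv_lhs => rw [pi_eq_sum_univ' x]
    simp [map_sum, mul_comm]
  refine hf (LinearMap.ext fun x => ?_)
  have hc := h (fun l => f (Pi.single l 1)) fun q => by
    rw [← hrep]
    exact hle (Submodule.subset_span ⟨q, rfl⟩)
  rw [hrep]
  simp [funext_iff] at hc
  simp [hc]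

theorem mem_of_forall_sum_smul_mem {k : ℕ} {α E : Type*} [AddCommGroup E] [Module ℝ E]
    {v : α → Fin k → ℝ} (hv : Submodule.span ℝ (Set.range v) = ⊤) (Z : Submodule ℝ E)
    {a : Fin k → E} (h : ∀ q, ∑ l, v q l • a l ∈ Z) (l : Fin k) : a l ∈ Z := by
  have hle : Submodule.span ℝ (Set.range v) ≤ Z.comap (Fintype.linearCombination ℝ a) := by
    rw [Submodule.span_le]
    rintro _ ⟨q, rfl⟩
    simpa [Fintype.linearCombination_apply] using h q
  rw [hv] at hle
  have : (Pi.single l 1 : Fin k → ℝ) ∈ Z.comap (Fintype.linearCombination ℝ a) := hle trivial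
  simpa [Fintype.linearCombination_apply_single] using this

theorem eq_of_forall_sum_smul_eq {k : ℕ} {α E : Type*} [AddCommGroup E] [Module ℝ E]
    {v : α → Fin k → ℝ} (hv : Submodule.span ℝ (Set.range v) = ⊤)
    {a b : Fin k → E} (h : ∀ q, ∑ l, v q l • a l = ∑ l, v q l • b l) (l : Fin k) :
    a l = b l := by
  have := mem_of_forall_sum_smul_mem hv (⊥ : Submodule ℝ E) (a := fun l => a l - b l)
    (fun q => by simp [smul_sub, Finset.sum_sub_distrib, h q]) l
  simpa [sub_eq_zero] using this

theorem affineCombination_eq_sum {nψ : ℕ} {a b : Type} (X : Fin (nψ + 1) → Matrix a b ℝ)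
    (v : Fin nψ → ℝ) :
    affineCombination X v = ∑ l, (Fin.cons 1 v : Fin (nψ + 1) → ℝ) l • X l := by
  simp [affineCombination, Fin.sum_univ_succ]

theorem affineCombination_mulVec {nψ : ℕ} {a b : Type} [Fintype b]
    (X : Fin (nψ + 1) → Matrix a b ℝ) (v : Fin nψ → ℝ) (x : b → ℝ) :
    affineCombination X v *ᵥ x = ∑ l, (Fin.cons 1 v : Fin (nψ + 1) → ℝ) l • (X l *ᵥ x) := by
  simp [affineCombination_eq_sum, sum_mulVec, smul_mulVec]

theorem span_range_cons_one_eq_top {np nψ : ℕ} {ψ : SchedulingSet np → Fin nψ → ℝ}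
    (hψ : LinearIndependent ℝ (oneAndComponents ψ)) :
    Submodule.span ℝ (Set.range fun q => (Fin.cons 1 (ψ q) : Fin (nψ + 1) → ℝ)) = ⊤ := by
  refine span_range_eq_top_of_forall_sum_mul_eq_zero fun c hc => ?_
  refine funext (Fintype.linearIndependent_iff.1 hψ c (funext fun q => ?_))
  simpa [oneAndComponents, Fin.sum_univ_succ] using hc q

namespace FALPV

variable {np nψ nx nx' nu ny : ℕ}

/-! ### Bisimulations and input-output equivalence of FALPVs -/

/-- A bisimulation between two FALPVs: a linear relation between the state spaces that is
compatible with all the constant matrices. -/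
structure IsBisimulation (S : FALPV nψ nx nu ny) (S' : FALPV nψ nx' nu ny)
    (Z : Submodule ℝ ((Fin nx → ℝ) × (Fin nx' → ℝ))) : Prop where
  B_mem : ∀ l u, (S.B l *ᵥ u, S'.B l *ᵥ u) ∈ Z
  A_mem : ∀ l, ∀ x ∈ Z, (S.A l *ᵥ x.1, S'.A l *ᵥ x.2) ∈ Z
  C_eq : ∀ l, ∀ x ∈ Z, S.C l *ᵥ x.1 = S'.C l *ᵥ x.2
  D_eq : ∀ l u, S.D l *ᵥ u = S'.D l *ᵥ u

theorem affineCombination_mulVec_prod {b b' c c' : Type} [Fintype b] [Fintype b']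
    (X : Fin (nψ + 1) → Matrix c b ℝ) (X' : Fin (nψ + 1) → Matrix c' b' ℝ) (v : Fin nψ → ℝ)
    (x : b → ℝ) (x' : b' → ℝ) :
    (affineCombination X v *ᵥ x, affineCombination X' v *ᵥ x') =
      ∑ l, (Fin.cons 1 v : Fin (nψ + 1) → ℝ) l • (X l *ᵥ x, X' l *ᵥ x') := by
  ext1 <;> simp [affineCombination_mulVec, Prod.fst_sum, Prod.snd_sum]

theorem IsBisimulation.ioEquivalent {S : FALPV nψ nx nu ny} {S' : FALPV nψ nx' nu ny}
    {Z : Submodule ℝ ((Fin nx → ℝ) × (Fin nx' → ℝ))} (h : IsBisimulation S S' Z)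
    (ψ : SchedulingSet np → Fin nψ → ℝ) : IOEquivalent ψ S S' := by
  funext u p t
  have hmem : ∀ t, (S.zeroState ψ u p t, S'.zeroState ψ u p t) ∈ Z := by
    intro t
    induction t with
    | zero => exact Z.zero_mem
    | succ t ih =>
      rw [zeroState, zeroState, ← Prod.mk_add_mk, affineCombination_mulVec_prod,
        affineCombination_mulVec_prod]
      exact Z.add_mem (Z.sum_mem fun l _ => Z.smul_mem _ (h.A_mem l _ ih))
        (Z.sum_mem fun l _ => Z.smul_mem _ (h.B_mem l _))
  rw [ioMap, ioMap]
  simp only [affineCombination_mulVec, h.D_eq, h.C_eq _ _ (hmem t)]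

/-- The state at time `t` depends only on the inputs before `t`. -/
theorem zeroState_congr (S : FALPV nψ nx nu ny) (ψ : SchedulingSet np → Fin nψ → ℝ)
    {u u' : ℕ → Fin nu → ℝ} {p p' : ℕ → SchedulingSet np} {t : ℕ}
    (hu : ∀ τ < t, u τ = u' τ) (hp : ∀ τ < t, p τ = p' τ) :
    S.zeroState ψ u p t = S.zeroState ψ u' p' t := by
  induction t with
  | zero => rfl
  | succ t ih =>
    rw [zeroState, zeroState, hu t (Nat.lt_succ_self t), hp t (Nat.lt_succ_self t),
      ih (fun τ hτ => hu τ (hτ.trans (Nat.lt_succ_self t)))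
        (fun τ hτ => hp τ (hτ.trans (Nat.lt_succ_self t)))]

/-- The pairs of states reached simultaneously from zero span a bisimulation between input-output
equivalent FALPVs. As `1, ψ_1, …, ψ_{n_ψ}` are linearly independent, the equations between the
affine combinations of the constant matrices hold for the constant matrices themselves. -/
theorem IOEquivalent.exists_isBisimulation {ψ : SchedulingSet np → Fin nψ → ℝ}
    (hψ : LinearIndependent ℝ (oneAndComponents ψ)) {S : FALPV nψ nx nu ny}
    {S' : FALPV nψ nx' nu ny} (h : IOEquivalent ψ S S') : ∃ Z, IsBisimulation S S' Z := by
  have hspan := span_range_cons_one_eq_top hψ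
  let G : Set ((Fin nx → ℝ) × (Fin nx' → ℝ)) :=
    {x | ∃ u p t, x = (S.zeroState ψ u p t, S'.zeroState ψ u p t)}
  -- every pair of states in `G` can be followed by an arbitrary input and scheduling parameter
  have hstep : ∀ x ∈ G, ∀ (q : SchedulingSet np) (v : Fin nu → ℝ),
      (affineCombination S.A (ψ q) *ᵥ x.1 + affineCombination S.B (ψ q) *ᵥ v,
        affineCombination S'.A (ψ q) *ᵥ x.2 + affineCombination S'.B (ψ q) *ᵥ v) ∈ G ∧
      affineCombination S.C (ψ q) *ᵥ x.1 + affineCombination S.D (ψ q) *ᵥ v =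
        affineCombination S'.C (ψ q) *ᵥ x.2 + affineCombination S'.D (ψ q) *ᵥ v := by
    rintro _ ⟨u, p, t, rfl⟩ q v
    have hc : ∀ {k : ℕ} (R : FALPV nψ k nu ny),
        R.zeroState ψ (Function.update u t v) (Function.update p t q) t = R.zeroState ψ u p t :=
      fun R => R.zeroState_congr ψ (fun τ hτ => Function.update_of_ne hτ.ne _ _)
        (fun τ hτ => Function.update_of_ne hτ.ne _ _)
    constructor
    · refine ⟨Function.update u t v, Function.update p t q, t + 1, ?_⟩
      simp [zeroState, hc]
    · have := congrFun (congrFun (congrFun h (Function.update u t v)) (Function.update p t q)) t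
      simpa [ioMap, hc] using this
  have h0 : (0 : (Fin nx → ℝ) × (Fin nx' → ℝ)) ∈ G := ⟨0, fun _ => ⟨0, by simp⟩, 0, rfl⟩
  refine ⟨Submodule.span ℝ G, ⟨fun l u => ?_, fun l => ?_, fun l => ?_, fun l u => ?_⟩⟩
  · refine mem_of_forall_sum_smul_mem hspan (Submodule.span ℝ G)
      (a := fun l => (S.B l *ᵥ u, S'.B l *ᵥ u)) (fun q => ?_) l
    rw [← affineCombination_mulVec_prod]
    simpa using Submodule.subset_span (R := ℝ) (hstep 0 h0 q u).1
  · have hle : Submodule.span ℝ G ≤ (Submodule.span ℝ G).comap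
        ((S.A l).mulVecLin.prodMap (S'.A l).mulVecLin) := by
      rw [Submodule.span_le]
      intro x hx
      refine mem_of_forall_sum_smul_mem hspan (Submodule.span ℝ G)
        (a := fun l => (S.A l *ᵥ x.1, S'.A l *ᵥ x.2)) (fun q => ?_) l
      rw [← affineCombination_mulVec_prod]
      simpa using Submodule.subset_span (R := ℝ) (hstep x hx q 0).1
    exact fun x hx => hle hx
  · have hle : Submodule.span ℝ G ≤ LinearMap.eqLocus
        ((S.C l).mulVecLin.comp (LinearMap.fst ℝ _ _))
        ((S'.C l).mulVecLin.comp (LinearMap.snd ℝ _ _)) := by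
      rw [Submodule.span_le]
      intro x hx
      refine eq_of_forall_sum_smul_eq hspan
        (a := fun l => S.C l *ᵥ x.1) (b := fun l => S'.C l *ᵥ x.2) (fun q => ?_) l
      rw [← affineCombination_mulVec, ← affineCombination_mulVec]
      simpa using (hstep x hx q 0).2
    exact fun x hx => hle hx
  · refine eq_of_forall_sum_smul_eq hspan
      (a := fun l => S.D l *ᵥ u) (b := fun l => S'.D l *ᵥ u) (fun q => ?_) l
    rw [← affineCombination_mulVec, ← affineCombination_mulVec]
    simpa using (hstep 0 h0 q u).2

/-! ### Reachability and observability of minimal FALPVs -/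

/-- A linear map that intertwines the constant matrices has a bisimulation as its graph. -/
theorem isBisimulation_graph {S : FALPV nψ nx nu ny} {S' : FALPV nψ nx' nu ny}
    (T : Matrix (Fin nx') (Fin nx) ℝ) (hB : ∀ l, T * S.B l = S'.B l)
    (hA : ∀ l, T * S.A l = S'.A l * T) (hC : ∀ l, S.C l = S'.C l * T) (hD : S.D = S'.D) :
    IsBisimulation S S' T.mulVecLin.graph where
  B_mem l u := by simp [LinearMap.mem_graph_iff, mulVec_mulVec, hB]
  A_mem l x hx := by
    rw [LinearMap.mem_graph_iff, mulVecLin_apply] at hx ⊢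
    rw [hx, mulVec_mulVec, mulVec_mulVec, hA]
  C_eq l x hx := by
    rw [LinearMap.mem_graph_iff, mulVecLin_apply] at hx
    rw [hx, mulVec_mulVec, hC]
  D_eq l u := by rw [hD]

theorem IsMinimal.eq_top_of_invariant {ψ : SchedulingSet np → Fin nψ → ℝ}
    {S : FALPV nψ nx nu ny} (h : IsMinimal ψ S) (W : Submodule ℝ (Fin nx → ℝ))
    (hB : ∀ l u, S.B l *ᵥ u ∈ W) (hA : ∀ l, ∀ x ∈ W, S.A l *ᵥ x ∈ W) : W = ⊤ := by
  obtain ⟨J, L, -, hJ, hJL⟩ := exists_subspace_matrix W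
  have hJLX : ∀ {k : ℕ} (X : Matrix (Fin nx) (Fin k) ℝ),
      (∀ u, X *ᵥ u ∈ W) → J * (L * X) = X := by
    intro k X hX
    refine Matrix.ext_of_mulVec_single fun i => ?_
    rw [← mulVec_mulVec, ← mulVec_mulVec]
    exact hJL _ (hX _)
  let S' : FALPV nψ (Module.finrank ℝ W) nu ny :=
    ⟨fun l => L * (S.A l * J), fun l => L * S.B l, fun l => S.C l * J, S.D⟩
  have hbis : IsBisimulation S' S J.mulVecLin.graph := by
    refine isBisimulation_graph J (fun l => hJLX _ (hB l)) (fun l => hJLX _ fun u => ?_)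
      (fun l => rfl) rfl
    rw [← mulVec_mulVec]
    exact hA l _ (hJ u)
  have hle := h _ S' (hbis.ioEquivalent ψ)
  refine Submodule.eq_top_of_finrank_eq (le_antisymm (Submodule.finrank_le W) ?_)
  simpa using hle

theorem IsMinimal.eq_bot_of_invariant {ψ : SchedulingSet np → Fin nψ → ℝ}
    {S : FALPV nψ nx nu ny} (h : IsMinimal ψ S) (U : Submodule ℝ (Fin nx → ℝ))
    (hC : ∀ l, ∀ x ∈ U, S.C l *ᵥ x = 0) (hA : ∀ l, ∀ x ∈ U, S.A l *ᵥ x ∈ U) : U = ⊥ := by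
  obtain ⟨Q, J, hQJ, hQ⟩ := exists_quotient_matrix U
  have hU : ∀ x, x - J *ᵥ (Q *ᵥ x) ∈ U := by
    intro x
    rw [← hQ, mulVec_sub, mulVec_mulVec _ Q, hQJ, one_mulVec, sub_self]
  have hXJQ : ∀ {k : ℕ} (X : Matrix (Fin k) (Fin nx) ℝ),
      (∀ x ∈ U, X *ᵥ x = 0) → X = X * J * Q := by
    intro k X hX
    refine Matrix.ext_of_mulVec_single fun i => ?_
    have := hX _ (hU (Pi.single i 1))
    rw [mulVec_sub, sub_eq_zero] at this
    rw [← mulVec_mulVec, ← mulVec_mulVec]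
    exact this
  let S' : FALPV nψ (Module.finrank ℝ ((Fin nx → ℝ) ⧸ U)) nu ny :=
    ⟨fun l => Q * S.A l * J, fun l => Q * S.B l, fun l => S.C l * J, S.D⟩
  have hbis : IsBisimulation S S' Q.mulVecLin.graph := by
    refine isBisimulation_graph Q (fun l => rfl) (fun l => hXJQ _ fun x hx => ?_)
      (fun l => hXJQ _ (hC l)) rfl
    rw [← mulVec_mulVec, hQ]
    exact hA l x hx
  have hle := h _ S' (hbis.ioEquivalent ψ).symm
  have hsum := Submodule.finrank_quotient_add_finrank U
  rw [Module.finrank_fin_fun] at hsum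
  exact Submodule.finrank_eq_zero.1 (by omega)

end FALPV

namespace LFT

variable {p m ι : Type}

/-! ### Stable realizations of matrix-valued series -/

open scoped Kronecker in
/-- The LFT with the formal input-output map `∑_l S^l E_l`, for an LFT with the column-valued
formal input-output map `S` and matrices `E_l`: the direct sum of as many copies of the given LFT
as the `E_l` have columns. Its block `i` has the coordinates `Fin (M.n i) × m`, enumerated. -/
noncomputable def tensor [Fintype m] [DecidableEq m] {k : ℕ} (M : LFT (Fin k) (Fin 1) ι)
    (E : Fin k → Matrix p m ℝ) : LFT p m ι :=
  let e : ∀ i, Fin (Fintype.card (Fin (M.n i) × m)) ≃ Fin (M.n i) × m :=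
    fun _ => (Fintype.equivFin _).symm
  ofBlocks (fun i => Fintype.card (Fin (M.n i) × m))
    (fun i j => (M.blockA i j ⊗ₖ (1 : Matrix m m ℝ)).submatrix (e i) (e j))
    (fun i => (M.blockB i ⊗ₖ (1 : Matrix m m ℝ)).submatrix (e i) (fun b => (0, b)))
    (fun i => (Matrix.of (fun (a : p) (s : Fin k × m) => E s.1 a s.2) *
      (M.blockC i ⊗ₖ (1 : Matrix m m ℝ))).submatrix id (e i))
    0

section tensor

variable [Fintype m] [DecidableEq m] {k : ℕ} (M : LFT (Fin k) (Fin 1) ι)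
  (E : Fin k → Matrix p m ℝ)

open scoped Kronecker in
theorem tensor_obs (i : ι) (w : List ι) :
    (M.tensor E).obs i w = (Matrix.of (fun (a : p) (s : Fin k × m) => E s.1 a s.2) *
      (M.obs i w ⊗ₖ (1 : Matrix m m ℝ))).submatrix id (Fintype.equivFin _).symm := by
  induction w generalizing i with
  | nil => rfl
  | cons j w ih =>
    rw [obs, ih]
    refine (submatrix_mul_equiv (Matrix.of (fun (a : p) (s : Fin k × m) => E s.1 a s.2) *
      (M.obs j w ⊗ₖ (1 : Matrix m m ℝ))) (M.blockA j i ⊗ₖ (1 : Matrix m m ℝ)) id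
      (Fintype.equivFin (Fin (M.n j) × m)).symm _).trans ?_
    rw [Matrix.mul_assoc, ← mul_kronecker_mul, Matrix.one_mul, obs]
    rfl

open scoped Kronecker in
theorem tensor_formalMap_cons (i : ι) (w : List ι) :
    (M.tensor E).formalMap (i :: w) = ∑ l, M.formalMap (i :: w) l 0 • E l := by
  rw [formalMap_cons, tensor_obs]
  refine (submatrix_mul_equiv (Matrix.of (fun (a : p) (s : Fin k × m) => E s.1 a s.2) *
    (M.obs i w ⊗ₖ (1 : Matrix m m ℝ))) (M.blockB i ⊗ₖ (1 : Matrix m m ℝ)) id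
    (Fintype.equivFin (Fin (M.n i) × m)).symm _).trans ?_
  rw [Matrix.mul_assoc, ← mul_kronecker_mul, Matrix.one_mul, ← formalMap_cons]
  ext a b
  simp [Matrix.mul_apply, Matrix.sum_apply, Fintype.sum_prod_type, Matrix.one_apply, mul_comm]

open scoped Kronecker in
theorem IsStable.tensor [Fintype ι] [DecidableEq ι] {M : LFT (Fin k) (Fin 1) ι} (h : M.IsStable)
    (E : Fin k → Matrix p m ℝ) : (M.tensor E).IsStable := by
  obtain ⟨P, hP, hlt⟩ := h
  let e : ∀ i, Fin (Fintype.card (Fin (M.n i) × m)) ≃ Fin (M.n i) × m :=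
    fun i => (Fintype.equivFin _).symm
  let ε : (M.tensor E).Coord ≃ M.Coord × m :=
    (Equiv.sigmaCongrRight e).trans (Equiv.sigmaProdDistrib _ _).symm
  refine ⟨fun i => (P i ⊗ₖ (1 : Matrix m m ℝ)).submatrix (e i) (e i),
    fun i => ((hP i).kronecker PosDef.one).submatrix (e i).injective, ?_⟩
  have hD : Matrix.blockDiagonal' (fun i => (P i ⊗ₖ (1 : Matrix m m ℝ)).submatrix (e i) (e i)) =
      (Matrix.blockDiagonal' P ⊗ₖ (1 : Matrix m m ℝ)).submatrix ε ε := by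
    ext ⟨i, a⟩ ⟨j, b⟩
    by_cases hij : i = j
    · subst hij
      change _ = Matrix.blockDiagonal' P ⟨i, (e i a).1⟩ ⟨i, (e i b).1⟩ *
        (1 : Matrix m m ℝ) (e i a).2 (e i b).2
      simp [blockDiagonal'_apply_eq]
    · change _ = Matrix.blockDiagonal' P ⟨i, (e i a).1⟩ ⟨j, (e j b).1⟩ *
        (1 : Matrix m m ℝ) (e i a).2 (e j b).2
      simp [blockDiagonal'_apply_ne _ _ _ hij]
  have hpos := (hlt.kronecker (PosDef.one (n := m) (R := ℝ))).submatrix ε.injective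
  have heq : ((Matrix.blockDiagonal' P - M.Aᵀ * Matrix.blockDiagonal' P * M.A) ⊗ₖ
      (1 : Matrix m m ℝ)).submatrix ε ε =
      (Matrix.blockDiagonal' P ⊗ₖ (1 : Matrix m m ℝ)).submatrix ε ε -
        ((M.A ⊗ₖ (1 : Matrix m m ℝ)).submatrix ε ε)ᵀ *
          (Matrix.blockDiagonal' P ⊗ₖ (1 : Matrix m m ℝ)).submatrix ε ε *
          (M.A ⊗ₖ (1 : Matrix m m ℝ)).submatrix ε ε := by
    rw [transpose_submatrix, submatrix_mul_equiv, submatrix_mul_equiv, ← kroneckerMap_transpose,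
      transpose_one, ← mul_kronecker_mul, ← mul_kronecker_mul, Matrix.one_mul, Matrix.one_mul]
    ext s t
    simp [sub_mul]
  rw [heq, ← hD] at hpos
  exact hpos

end tensor

end LFT

/-! ### The formal map of a realization -/

theorem LFT.C_mul_deltaMatrix_mul_inv_mul_B_mulVec {p m ι : Type} [Fintype ι] [DecidableEq ι]
    [Fintype m] (M : LFT p m ι) (q : ι → ℝ) (u : m → ℝ) :
    (M.C * M.deltaMatrix q * (1 - M.A * M.deltaMatrix q)⁻¹ * M.B) *ᵥ u =
      ∑ j, q j • (M.blockC j *ᵥ M.blk ((1 - M.A * M.deltaMatrix q)⁻¹ *ᵥ (M.B *ᵥ u)) j) := by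
  rw [← mulVec_mulVec, ← mulVec_mulVec, ← mulVec_mulVec, LFT.C_mulVec]
  simp only [LFT.blk_deltaMatrix_mulVec, mulVec_smul]

theorem IsRealization.apply_eq {np nψ : ℕ} {ψ : SchedulingSet np → Fin nψ → ℝ}
    {M : LFT (Fin nψ) (Fin 1) (Fin np)} (hM : IsRealization M ψ) (q : SchedulingSet np) :
    ψ q = ∑ j, q.1 j •
      (M.blockC j *ᵥ M.blk ((1 - M.A * M.deltaMatrix q.1)⁻¹ *ᵥ (M.B *ᵥ 1)) j) := by
  rw [← LFT.C_mul_deltaMatrix_mul_inv_mul_B_mulVec]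
  funext l
  rw [hM.eq]
  simp [mulVec, dotProduct]

theorem LFT.obs_mulVec_blockB_mulVec {p m ι : Type} [Fintype m] (M : LFT p m ι) (i : ι)
    (w : List ι) (u : m → ℝ) :
    M.obs i w *ᵥ (M.blockB i *ᵥ u) = M.formalMap (i :: w) *ᵥ u := by
  rw [M.formalMap_cons, mulVec_mulVec]

/-- A linear relation between the components of the formal input-output map of a realization of
`ψ` is one between the components of `ψ`. -/
theorem IsRealization.span_range_formalMap_eq_top {np nψ : ℕ}
    {ψ : SchedulingSet np → Fin nψ → ℝ} {M : LFT (Fin nψ) (Fin 1) (Fin np)} (hM : IsRealization M ψ)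
    (hψ : LinearIndependent ℝ (oneAndComponents ψ)) :
    Submodule.span ℝ (Set.range fun (ν : Fin np × List (Fin np)) (l : Fin nψ) =>
      M.formalMap (ν.1 :: ν.2) l 0) = ⊤ := by
  refine span_range_eq_top_of_forall_sum_mul_eq_zero fun c hc => ?_
  let f : ∀ i : Fin np, List (Fin np) → (Fin (M.n i) → ℝ) →ₗ[ℝ] ℝ := fun i w =>
    (Fintype.linearCombination ℝ c).comp (M.obs i w).mulVecLin
  have hf : ∀ i w x, f i w x = ∑ l, c l * (M.obs i w *ᵥ x) l := by
    intro i w x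
    simp [f, Fintype.linearCombination_apply, mul_comm]
  have hmem : ∀ (q : SchedulingSet np) i w,
      f i w (M.blk ((1 - M.A * M.deltaMatrix q.1)⁻¹ *ᵥ (M.B *ᵥ 1)) i) = 0 := by
    intro q i
    have hu := hM.stable.isUnit_one_sub q.2
    have := LFT.resolvent_mem_relation M M q.1 hu hu
      (fun i => ⨅ w, LinearMap.ker ((f i w).comp (LinearMap.fst ℝ _ (Fin (M.n i) → ℝ))))
      (fun i j x hx => ?_) (M.B *ᵥ 1) (M.B *ᵥ 1) (fun i => ?_) i
    · simpa [Submodule.mem_iInf] using this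
    · rw [Submodule.mem_iInf] at hx ⊢
      intro w
      have := hx (j :: w)
      rw [LinearMap.mem_ker, LinearMap.comp_apply, hf] at this ⊢
      simpa [LFT.obs, mulVec_mulVec] using this
    · rw [Submodule.mem_iInf]
      intro w
      rw [LinearMap.mem_ker, LinearMap.comp_apply, hf, LinearMap.fst_apply, LFT.blk_B_mulVec,
        LFT.obs_mulVec_blockB_mulVec]
      simpa [mulVec, dotProduct] using hc (i, w)
  have h0 : ∀ q : SchedulingSet np, ∑ l, c l * ψ q l = 0 := by
    intro q
    have : ∑ l, c l * ψ q l = Fintype.linearCombination ℝ c (ψ q) := by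
      simp [Fintype.linearCombination_apply, mul_comm]
    rw [this, hM.apply_eq q, map_sum]
    refine Finset.sum_eq_zero fun j _ => ?_
    rw [map_smul]
    have := hmem q j []
    simp only [f, LinearMap.comp_apply, mulVecLin_apply, LFT.obs] at this
    rw [this, smul_zero]
  have hli := Fintype.linearIndependent_iff.1 hψ (Fin.cons 0 c) (funext fun q => by
    simpa [oneAndComponents, Fin.sum_univ_succ] using h0 q)
  funext l
  simpa using hli l.succ

namespace FALPV

variable {np nψ nx nx' nu ny : ℕ}

section series

variable {S : FALPV nψ nx nu ny} {M : LFT (Fin nψ) (Fin 1) (Fin np)}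
  {N : LFT (Fin nx ⊕ Fin ny) (Fin nx ⊕ Fin nu) (Fin np)}

theorem IsSeriesRealization.obs_mulVec (hN : S.IsSeriesRealization M N) (i : Fin np)
    (w : List (Fin np)) (v : Fin nx ⊕ Fin nu → ℝ) :
    N.obs i w *ᵥ (N.blockB i *ᵥ v) = ∑ l : Fin nψ, M.formalMap (i :: w) l 0 •
      (fromBlocks (S.A l.succ) (S.B l.succ) (S.C l.succ) (S.D l.succ) *ᵥ v) := by
  rw [LFT.obs_mulVec_blockB_mulVec, hN.eq, seriesMap]
  simp [sum_mulVec, smul_mulVec]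

theorem IsSeriesRealization.obs_mulVec_inl (hN : S.IsSeriesRealization M N) (i : Fin np)
    (w : List (Fin np)) (x : Fin nx → ℝ) (u : Fin nu → ℝ) :
    (N.obs i w *ᵥ (N.blockB i *ᵥ Sum.elim x u)) ∘ Sum.inl =
      ∑ l : Fin nψ, M.formalMap (i :: w) l 0 • (S.A l.succ *ᵥ x + S.B l.succ *ᵥ u) := by
  rw [hN.obs_mulVec]
  funext a
  simp [fromBlocks_mulVec, Finset.sum_apply, mul_add]

theorem IsSeriesRealization.obs_mulVec_inr (hN : S.IsSeriesRealization M N) (i : Fin np)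
    (w : List (Fin np)) (x : Fin nx → ℝ) (u : Fin nu → ℝ) :
    (N.obs i w *ᵥ (N.blockB i *ᵥ Sum.elim x u)) ∘ Sum.inr =
      ∑ l : Fin nψ, M.formalMap (i :: w) l 0 • (S.C l.succ *ᵥ x + S.D l.succ *ᵥ u) := by
  rw [hN.obs_mulVec]
  funext a
  simp [fromBlocks_mulVec, Finset.sum_apply, mul_add]

/-- A realization of `∑_l S^l E_l` has the transfer function `∑_l ψ_l E_l`. -/
theorem IsSeriesRealization.transfer_mulVec (hN : S.IsSeriesRealization M N)
    {ψ : SchedulingSet np → Fin nψ → ℝ} (hM : IsRealization M ψ) (q : SchedulingSet np)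
    (v : Fin nx ⊕ Fin nu → ℝ) :
    (N.C * N.deltaMatrix q.1 * (1 - N.A * N.deltaMatrix q.1)⁻¹ * N.B) *ᵥ v =
      ∑ l : Fin nψ, ψ q l •
        (fromBlocks (S.A l.succ) (S.B l.succ) (S.C l.succ) (S.D l.succ) *ᵥ v) := by
  set g : (Fin nψ → ℝ) →ₗ[ℝ] (Fin nx ⊕ Fin ny → ℝ) := Fintype.linearCombination ℝ
    fun l => fromBlocks (S.A l.succ) (S.B l.succ) (S.C l.succ) (S.D l.succ) *ᵥ v with hg
  have key : ∀ i, N.blockC i *ᵥ N.blk ((1 - N.A * N.deltaMatrix q.1)⁻¹ *ᵥ (N.B *ᵥ v)) i =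
      g (M.blockC i *ᵥ M.blk ((1 - M.A * M.deltaMatrix q.1)⁻¹ *ᵥ (M.B *ᵥ 1)) i) := by
    intro i
    -- the states from which `N` produces the outputs of `M` multiplied by the `E_l v`
    have := LFT.resolvent_mem_relation N M q.1 (hN.stable.isUnit_one_sub q.2)
      (hM.stable.isUnit_one_sub q.2)
      (fun i => ⨅ w, LinearMap.eqLocus
        ((N.obs i w).mulVecLin.comp (LinearMap.fst ℝ _ (Fin (M.n i) → ℝ)))
        (g.comp ((M.obs i w).mulVecLin.comp (LinearMap.snd ℝ _ _))))
      (fun i j x hx => ?_) (N.B *ᵥ v) (M.B *ᵥ 1) (fun i => ?_) i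
    · rw [Submodule.mem_iInf] at this
      exact this []
    · rw [Submodule.mem_iInf] at hx ⊢
      intro w
      have := hx (j :: w)
      rw [LinearMap.mem_eqLocus] at this ⊢
      simpa [LFT.obs, mulVec_mulVec] using this
    · rw [Submodule.mem_iInf]
      intro w
      rw [LinearMap.mem_eqLocus]
      simp only [LinearMap.comp_apply, LinearMap.fst_apply, LinearMap.snd_apply, mulVecLin_apply,
        LFT.blk_B_mulVec]
      rw [hN.obs_mulVec, LFT.obs_mulVec_blockB_mulVec, hg, Fintype.linearCombination_apply]
      simp [mulVec, dotProduct]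
  have hgψ : ∑ l : Fin nψ, ψ q l •
      (fromBlocks (S.A l.succ) (S.B l.succ) (S.C l.succ) (S.D l.succ) *ᵥ v) = g (ψ q) := by
    rw [hg, Fintype.linearCombination_apply]
  rw [hgψ, LFT.C_mul_deltaMatrix_mul_inv_mul_B_mulVec, hM.apply_eq q, map_sum]
  exact Finset.sum_congr rfl fun j _ => by rw [key, map_smul]

end series

/-! ### The associated LFT -/

section toLFT

variable (S : FALPV nψ nx nu ny) (N : LFT (Fin nx ⊕ Fin ny) (Fin nx ⊕ Fin nu) (Fin np))

theorem toLFT_blockA_some_none (i : Fin np) (x : Fin nx → ℝ) :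
    (S.toLFT N).blockA (some i) none *ᵥ x = N.blockB i *ᵥ Sum.elim x 0 := by
  funext a
  simp only [mulVec, dotProduct, Fintype.sum_sum_type, Sum.elim_inl, Sum.elim_inr,
    Pi.zero_apply, mul_zero, Finset.sum_const_zero, add_zero]
  rfl

theorem toLFT_blockB_some (i : Fin np) (u : Fin nu → ℝ) :
    (S.toLFT N).blockB (some i) *ᵥ u = N.blockB i *ᵥ Sum.elim 0 u := by
  funext a
  simp only [mulVec, dotProduct, Fintype.sum_sum_type, Sum.elim_inl, Sum.elim_inr,
    Pi.zero_apply, mul_zero, Finset.sum_const_zero, zero_add]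
  rfl

theorem blk_toLFT_A_mulVec_none (W : (S.toLFT N).Coord → ℝ) (x : Fin nx → ℝ) (ζ : N.Coord → ℝ)
    (h₀ : (S.toLFT N).blk W none = x) (h₁ : ∀ i, (S.toLFT N).blk W (some i) = N.blk ζ i) :
    (S.toLFT N).blk ((S.toLFT N).A *ᵥ W) none = S.A 0 *ᵥ x + (N.C *ᵥ ζ) ∘ Sum.inl := by
  rw [LFT.blk_A_mulVec, Fintype.sum_option, h₀, LFT.C_mulVec]
  simp only [h₁]
  funext a
  change ((S.toLFT N).blockA none none *ᵥ x +
    ∑ j, (S.toLFT N).blockA none (some j) *ᵥ N.blk ζ j) a =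
    (S.A 0 *ᵥ x) a + (∑ j, N.blockC j *ᵥ N.blk ζ j) (Sum.inl a)
  rw [Pi.add_apply, Finset.sum_apply, Finset.sum_apply]
  rfl

theorem blk_toLFT_A_mulVec_some (W : (S.toLFT N).Coord → ℝ) (x : Fin nx → ℝ) (ζ : N.Coord → ℝ)
    (h₀ : (S.toLFT N).blk W none = x) (h₁ : ∀ i, (S.toLFT N).blk W (some i) = N.blk ζ i)
    (i : Fin np) :
    (S.toLFT N).blk ((S.toLFT N).A *ᵥ W) (some i) =
      N.blk (N.B *ᵥ Sum.elim x 0 + N.A *ᵥ ζ) i := by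
  rw [LFT.blk_A_mulVec, Fintype.sum_option, h₀, toLFT_blockA_some_none, LFT.blk_add,
    LFT.blk_B_mulVec, LFT.blk_A_mulVec]
  simp only [h₁]
  rfl

theorem toLFT_C_mulVec (W : (S.toLFT N).Coord → ℝ) (x : Fin nx → ℝ) (ζ : N.Coord → ℝ)
    (h₀ : (S.toLFT N).blk W none = x) (h₁ : ∀ i, (S.toLFT N).blk W (some i) = N.blk ζ i) :
    (S.toLFT N).C *ᵥ W = S.C 0 *ᵥ x + (N.C *ᵥ ζ) ∘ Sum.inr := by
  rw [LFT.C_mulVec, Fintype.sum_option, h₀, LFT.C_mulVec]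
  funext a
  simp only [h₁, Pi.add_apply, Finset.sum_apply, Function.comp_apply]
  rfl

/-- The solutions of the associated LFT whose shift block carries a given state trajectory,
written out. -/
theorem isSolutionFrom_joinSignal_iff (x : ℕ → Fin nx → ℝ) (y : ℕ → Fin ny → ℝ)
    (u : ℕ → Fin nu → ℝ) (p : ℕ → SchedulingSet np) (zt : ℕ → N.Coord → ℝ) :
    (S.toLFT N).IsSolutionFrom (schedulingUncertainty p) (S.initialSignal N (x 0))
        (S.joinSignal N (fun t => x (t + 1)) zt) y u ↔
      ∀ t, x (t + 1) = S.A 0 *ᵥ x t + (N.C *ᵥ (N.deltaMatrix (p t).1 *ᵥ zt t)) ∘ Sum.inl +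
          S.B 0 *ᵥ u t ∧
        zt t = N.B *ᵥ Sum.elim (x t) (u t) + N.A *ᵥ (N.deltaMatrix (p t).1 *ᵥ zt t) ∧
        y t = S.C 0 *ᵥ x t + (N.C *ᵥ (N.deltaMatrix (p t).1 *ᵥ zt t)) ∘ Sum.inr +
          S.D 0 *ᵥ u t := by
  set w := (S.toLFT N).blockOp (schedulingUncertainty p)
    (S.joinSignal N (fun t => x (t + 1)) zt) + S.initialSignal N (x 0) with hw
  have h₀ : ∀ t, (S.toLFT N).blk (w t) none = x t := by
    intro t
    funext a
    cases t with
    | zero =>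
      simp [hw, LFT.blk, LFT.blockOp, schedulingUncertainty, backwardShift, initialSignal,
        joinSignal]
    | succ t =>
      simp [hw, LFT.blk, LFT.blockOp, schedulingUncertainty, backwardShift, initialSignal,
        joinSignal]
      rfl
  have h₁ : ∀ t i, (S.toLFT N).blk (w t) (some i) = N.blk (N.deltaMatrix (p t).1 *ᵥ zt t) i := by
    intro t i
    rw [LFT.blk_deltaMatrix_mulVec]
    funext a
    simp [hw, LFT.blk, LFT.blockOp, schedulingUncertainty, mulSignal, initialSignal, joinSignal]
    rfl
  have hB : ∀ t, N.B *ᵥ Sum.elim (x t) (u t) =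
      N.B *ᵥ Sum.elim (x t) 0 + N.B *ᵥ Sum.elim 0 (u t) := by
    intro t
    rw [← mulVec_add]
    congr 1
    funext s
    cases s <;> simp
  have hiff : ∀ t, (S.joinSignal N (fun t => x (t + 1)) zt t =
      (S.toLFT N).A *ᵥ w t + (S.toLFT N).B *ᵥ u t) ↔
      x (t + 1) = S.A 0 *ᵥ x t + (N.C *ᵥ (N.deltaMatrix (p t).1 *ᵥ zt t)) ∘ Sum.inl +
          S.B 0 *ᵥ u t ∧
        zt t = N.B *ᵥ Sum.elim (x t) (u t) + N.A *ᵥ (N.deltaMatrix (p t).1 *ᵥ zt t) := by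
    intro t
    rw [← (S.toLFT N).blk_injective.eq_iff, funext_iff, Option.forall]
    refine and_congr ?_ ?_
    · rw [LFT.blk_add, blk_toLFT_A_mulVec_none S N _ _ _ (h₀ t) (h₁ t)]
      rfl
    · rw [← N.blk_injective.eq_iff, funext_iff]
      refine forall_congr' fun i => ?_
      rw [LFT.blk_add, blk_toLFT_A_mulVec_some S N _ _ _ (h₀ t) (h₁ t), LFT.blk_B_mulVec,
        toLFT_blockB_some, hB, add_right_comm, LFT.blk_add _ (_ + _)]
      rfl
  constructor
  · rintro ⟨_, rfl, h⟩ t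
    rw [← and_assoc]
    refine ⟨(hiff t).1 (h t).1, ?_⟩
    rw [(h t).2, toLFT_C_mulVec S N _ _ _ (h₀ t) (h₁ t)]
    rfl
  · intro h
    refine ⟨w, rfl, fun t => ⟨(hiff t).2 ⟨(h t).1, (h t).2.1⟩, ?_⟩⟩
    rw [(h t).2.2, toLFT_C_mulVec S N _ _ _ (h₀ t) (h₁ t)]
    rfl

end toLFT

/-! ### Solutions of the associated LFT -/

/-- The signal `z̃` is the resolvent of `𝓕 Δ` applied to `𝓖 (x, u)`. -/
theorem IsSeriesRealization.existsUnique_solution {S : FALPV nψ nx nu ny}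
    {M : LFT (Fin nψ) (Fin 1) (Fin np)} {N : LFT (Fin nx ⊕ Fin ny) (Fin nx ⊕ Fin nu) (Fin np)}
    (hN : S.IsSeriesRealization M N) {ψ : SchedulingSet np → Fin nψ → ℝ} (hM : IsRealization M ψ)
    {x : ℕ → Fin nx → ℝ} {y : ℕ → Fin ny → ℝ} {u : ℕ → Fin nu → ℝ} {p : ℕ → SchedulingSet np}
    (h : S.IsSolution ψ x y u p) :
    ∃! z : ℕ → (S.toLFT N).Coord → ℝ,
      (S.toLFT N).IsSolutionFrom (schedulingUncertainty p) (S.initialSignal N (x 0)) z y u ∧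
        ∃ zt : ℕ → N.Coord → ℝ, z = S.joinSignal N (fun t => x (t + 1)) zt := by
  have hunit : ∀ t, IsUnit (1 - N.A * N.deltaMatrix (p t).1).det := fun t =>
    (isUnit_iff_isUnit_det _).1 (hN.stable.isUnit_one_sub (p t).2)
  set zt : ℕ → N.Coord → ℝ := fun t =>
    (1 - N.A * N.deltaMatrix (p t).1)⁻¹ *ᵥ (N.B *ᵥ Sum.elim (x t) (u t)) with hzt
  have hres : ∀ (t : ℕ) (ζ : N.Coord → ℝ), ζ = N.B *ᵥ Sum.elim (x t) (u t) +
      N.A *ᵥ (N.deltaMatrix (p t).1 *ᵥ ζ) ↔ ζ = zt t := by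
    intro t ζ
    rw [← sub_eq_iff_eq_add, mulVec_mulVec]
    have : ζ - (N.A * N.deltaMatrix (p t).1) *ᵥ ζ = (1 - N.A * N.deltaMatrix (p t).1) *ᵥ ζ := by
      rw [sub_mulVec, one_mulVec]
    rw [this]
    constructor
    · intro hζ
      simp only [hzt]
      rw [← hζ, mulVec_mulVec, nonsing_inv_mul _ (hunit t), one_mulVec]
    · rintro rfl
      simp only [hzt]
      rw [mulVec_mulVec, mul_nonsing_inv _ (hunit t), one_mulVec]
  have hC : ∀ t, N.C *ᵥ (N.deltaMatrix (p t).1 *ᵥ zt t) = ∑ l : Fin nψ, ψ (p t) l •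
      (fromBlocks (S.A l.succ) (S.B l.succ) (S.C l.succ) (S.D l.succ) *ᵥ
        Sum.elim (x t) (u t)) := by
    intro t
    rw [← hN.transfer_mulVec hM (p t), ← mulVec_mulVec, ← mulVec_mulVec, ← mulVec_mulVec]
  refine ⟨S.joinSignal N (fun t => x (t + 1)) zt, ⟨?_, zt, rfl⟩, ?_⟩
  · refine (isSolutionFrom_joinSignal_iff S N x y u p zt).2 fun t =>
      ⟨?_, (hres t _).2 rfl, ?_⟩
    · rw [(h t).1, hC]
      funext a
      simp [affineCombination, add_mulVec, sum_mulVec, smul_mulVec, fromBlocks_mulVec,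
        Finset.sum_apply, mul_add, Finset.sum_add_distrib]
      ring
    · rw [(h t).2, hC]
      funext a
      simp [affineCombination, add_mulVec, sum_mulVec, smul_mulVec, fromBlocks_mulVec,
        Finset.sum_apply, mul_add, Finset.sum_add_distrib]
      ring
  · rintro _ ⟨hz, zt', rfl⟩
    have := (isSolutionFrom_joinSignal_iff S N x y u p zt').1 hz
    congr 1
    funext t
    exact (hres t _).1 (this t).2.1

theorem initialSignal_zero (S : FALPV nψ nx nu ny)
    (N : LFT (Fin nx ⊕ Fin ny) (Fin nx ⊕ Fin nu) (Fin np)) : S.initialSignal N 0 = 0 := by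
  funext t ⟨i, a⟩
  cases i
  · simp [initialSignal, joinSignal]
    rfl
  · rfl

end FALPV

/-! ### Existence of the associated LFT -/

/-- Outputs along all words stay within any set that contains the outputs of an invariant family
of relations. -/
theorem LFT.obs_mulVec_mem {p m p' m' ι : Type} (M : LFT p m ι) (M' : LFT p' m' ι)
    {Z : ∀ i, Submodule ℝ ((Fin (M.n i) → ℝ) × (Fin (M'.n i) → ℝ))}
    (hA : ∀ i j, ∀ x ∈ Z i, (M.blockA j i *ᵥ x.1, M'.blockA j i *ᵥ x.2) ∈ Z j)
    {Y : Set ((p → ℝ) × (p' → ℝ))}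
    (hC : ∀ i, ∀ x ∈ Z i, (M.blockC i *ᵥ x.1, M'.blockC i *ᵥ x.2) ∈ Y) (w : List ι) :
    ∀ i, ∀ x ∈ Z i, (M.obs i w *ᵥ x.1, M'.obs i w *ᵥ x.2) ∈ Y := by
  induction w with
  | nil => exact hC
  | cons j w ih =>
    intro i x hx
    simpa [LFT.obs, mulVec_mulVec] using ih j _ (hA i j x hx)

theorem sum_smul_prodMk {k : ℕ} {E E' : Type*} [AddCommGroup E] [Module ℝ E] [AddCommGroup E']
    [Module ℝ E'] (c : Fin k → ℝ) (f : Fin k → E) (g : Fin k → E') :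
    (∑ l, c l • f l, ∑ l, c l • g l) = ∑ l, c l • (f l, g l) := by
  ext1 <;> simp [Prod.fst_sum, Prod.snd_sum]

namespace FALPV

variable {np nψ nx nx' nu ny : ℕ}

/-- Copies of the realization of `ψ` give a stable LFT for the series of `S`, and a minimal
equivalent of it can be chosen stable. -/
theorem exists_isSeriesRealization (S : FALPV nψ nx nu ny) {M : LFT (Fin nψ) (Fin 1) (Fin np)}
    (hs : M.IsStable) (hD : M.D = 0) : ∃ N, S.IsSeriesRealization M N := by
  obtain ⟨N, he, hmin, hst⟩ := (hs.tensor fun l : Fin nψ =>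
    fromBlocks (S.A l.succ) (S.B l.succ) (S.C l.succ) (S.D l.succ)).exists_isMinimal
  have hmap : N.formalMap = S.seriesMap M := by
    rw [he]
    funext ν
    cases ν with
    | nil => simp [LFT.formalMap, LFT.tensor, LFT.ofBlocks, seriesMap, hD]
    | cons i w => rw [LFT.tensor_formalMap_cons, seriesMap]
  refine ⟨N, hmin, hst, ?_, hmap⟩
  have := congrFun hmap []
  simpa [LFT.formalMap, seriesMap, hD] using this

section

variable {S : FALPV nψ nx nu ny} {S' : FALPV nψ nx' nu ny} {M : LFT (Fin nψ) (Fin 1) (Fin np)}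
  {N : LFT (Fin nx ⊕ Fin ny) (Fin nx ⊕ Fin nu) (Fin np)}
  {N' : LFT (Fin nx' ⊕ Fin ny) (Fin nx' ⊕ Fin nu) (Fin np)}

/-! ### Formal equivalence of the associated LFTs -/

/-- A bisimulation between FALPVs extends to the associated LFTs: in the blocks of `N` and `N'`
the states are related whose outputs along all words are. -/
theorem IsBisimulation.formallyEquivalent_toLFT {Z : Submodule ℝ ((Fin nx → ℝ) × (Fin nx' → ℝ))}
    (h : IsBisimulation S S' Z) (hN : S.IsSeriesRealization M N)
    (hN' : S'.IsSeriesRealization M N') :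
    (S.toLFT N).FormallyEquivalent (S'.toLFT N') := by
  let Zs : ∀ i, Submodule ℝ ((Fin (N.n i) → ℝ) × (Fin (N'.n i) → ℝ)) := fun i =>
    { carrier := {z | ∀ w, ((N.obs i w *ᵥ z.1) ∘ Sum.inl, (N'.obs i w *ᵥ z.2) ∘ Sum.inl) ∈ Z ∧
        (N.obs i w *ᵥ z.1) ∘ Sum.inr = (N'.obs i w *ᵥ z.2) ∘ Sum.inr}
      add_mem' := by
        intro a b ha hb w
        rw [Prod.fst_add, Prod.snd_add, mulVec_add, mulVec_add]
        refine ⟨Z.add_mem (ha w).1 (hb w).1, ?_⟩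
        exact congrArg₂ (· + ·) (ha w).2 (hb w).2
      zero_mem' := by
        intro w
        rw [Prod.fst_zero, Prod.snd_zero, mulVec_zero, mulVec_zero]
        exact ⟨Z.zero_mem, rfl⟩
      smul_mem' := by
        intro c a ha w
        rw [Prod.smul_fst, Prod.smul_snd, mulVec_smul, mulVec_smul]
        exact ⟨Z.smul_mem c (ha w).1, congrArg (c • ·) (ha w).2⟩ }
  have hGx : ∀ i, ∀ x ∈ Z,
      (N.blockB i *ᵥ Sum.elim x.1 0, N'.blockB i *ᵥ Sum.elim x.2 0) ∈ Zs i := by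
    intro i x hx w
    simp only [hN.obs_mulVec_inl, hN'.obs_mulVec_inl, hN.obs_mulVec_inr, hN'.obs_mulVec_inr,
      mulVec_zero, add_zero]
    refine ⟨?_, by simp only [h.C_eq _ _ hx]⟩
    rw [sum_smul_prodMk]
    exact Z.sum_mem fun l _ => Z.smul_mem _ (h.A_mem l.succ x hx)
  have hGu : ∀ i u, (N.blockB i *ᵥ Sum.elim 0 u, N'.blockB i *ᵥ Sum.elim 0 u) ∈ Zs i := by
    intro i u w
    simp only [hN.obs_mulVec_inl, hN'.obs_mulVec_inl, hN.obs_mulVec_inr, hN'.obs_mulVec_inr,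
      mulVec_zero, zero_add]
    refine ⟨?_, by simp only [h.D_eq]⟩
    rw [sum_smul_prodMk]
    exact Z.sum_mem fun l _ => Z.smul_mem _ (h.B_mem l.succ u)
  have hF : ∀ i j, ∀ z ∈ Zs i, (N.blockA j i *ᵥ z.1, N'.blockA j i *ᵥ z.2) ∈ Zs j := by
    intro i j z hz w
    simpa [LFT.obs, mulVec_mulVec] using hz (j :: w)
  refine LFT.IsBisimulation.formallyEquivalent (Z := fun
    | none => Z
    | some i => Zs i) ⟨?_, ?_, ?_, ?_⟩
  · rintro (_ | i) u
    · exact h.B_mem 0 u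
    · rw [toLFT_blockB_some, toLFT_blockB_some]
      exact hGu i u
  · rintro (_ | i) (_ | j) x hx
    · exact h.A_mem 0 x hx
    · have := hGx j x hx
      rw [← toLFT_blockA_some_none S, ← toLFT_blockA_some_none S'] at this
      exact this
    · exact (hx []).1
    · exact hF i j x hx
  · rintro (_ | i) x hx
    · exact h.C_eq 0 x hx
    · exact (hx []).2
  · refine Matrix.ext_of_mulVec_single fun k => ?_
    exact h.D_eq 0 _

/-- Conversely, a bisimulation between the associated LFTs restricts to their shift blocks. The
words that leave and re-enter the shift block give the equations for the linear combinations of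
the constant matrices with the coefficients `S^l(ν)`, which span all linear combinations. -/
theorem exists_isBisimulation_of_formallyEquivalent_toLFT {ψ : SchedulingSet np → Fin nψ → ℝ}
    (hψ : LinearIndependent ℝ (oneAndComponents ψ)) (hM : IsRealization M ψ)
    (hN : S.IsSeriesRealization M N) (hN' : S'.IsSeriesRealization M N')
    (h : (S.toLFT N).FormallyEquivalent (S'.toLFT N')) : ∃ Z, IsBisimulation S S' Z := by
  have hspan := hM.span_range_formalMap_eq_top hψ
  have hb := h.isBisimulation
  set Zl := LFT.indistinguishable (S.toLFT N) (S'.toLFT N')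
  let Z : Submodule ℝ ((Fin nx → ℝ) × (Fin nx' → ℝ)) := Zl none
  let Zs : ∀ i, Submodule ℝ ((Fin (N.n i) → ℝ) × (Fin (N'.n i) → ℝ)) := fun i => Zl (some i)
  have hGx : ∀ i, ∀ x ∈ Z,
      (N.blockB i *ᵥ Sum.elim x.1 0, N'.blockB i *ᵥ Sum.elim x.2 0) ∈ Zs i := by
    intro i x hx
    rw [← toLFT_blockA_some_none S, ← toLFT_blockA_some_none S']
    exact hb.A_mem none (some i) x hx
  have hGu : ∀ i u, (N.blockB i *ᵥ Sum.elim 0 u, N'.blockB i *ᵥ Sum.elim 0 u) ∈ Zs i := by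
    intro i u
    rw [← toLFT_blockB_some S, ← toLFT_blockB_some S']
    exact hb.B_mem (some i) u
  have hobs := N.obs_mulVec_mem N' (Z := Zs)
    (Y := {y | (y.1 ∘ Sum.inl, y.2 ∘ Sum.inl) ∈ Z ∧ y.1 ∘ Sum.inr = y.2 ∘ Sum.inr})
    (fun i j x hx => hb.A_mem (some i) (some j) x hx)
    (fun i x hx => ⟨hb.A_mem (some i) none x hx, hb.C_eq (some i) x hx⟩)
  have hx' : ∀ x ∈ Z, ∀ l, (S.A l *ᵥ x.1, S'.A l *ᵥ x.2) ∈ Z ∧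
      S.C l *ᵥ x.1 = S'.C l *ᵥ x.2 := by
    intro x hx l
    refine Fin.cases ⟨hb.A_mem none none x hx, hb.C_eq none x hx⟩ (fun l => ⟨?_, ?_⟩) l
    · refine mem_of_forall_sum_smul_mem hspan Z
        (a := fun l => (S.A l.succ *ᵥ x.1, S'.A l.succ *ᵥ x.2)) (fun ν => ?_) l
      have := (hobs ν.2 ν.1 _ (hGx ν.1 x hx)).1
      simp only [hN.obs_mulVec_inl, hN'.obs_mulVec_inl, mulVec_zero, add_zero] at this
      rwa [sum_smul_prodMk] at this
    · refine eq_of_forall_sum_smul_eq hspan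
        (a := fun l => S.C l.succ *ᵥ x.1) (b := fun l => S'.C l.succ *ᵥ x.2) (fun ν => ?_) l
      have := (hobs ν.2 ν.1 _ (hGx ν.1 x hx)).2
      simpa only [hN.obs_mulVec_inr, hN'.obs_mulVec_inr, mulVec_zero, add_zero] using this
  have hu' : ∀ u l, (S.B l *ᵥ u, S'.B l *ᵥ u) ∈ Z ∧ S.D l *ᵥ u = S'.D l *ᵥ u := by
    intro u l
    refine Fin.cases ⟨hb.B_mem none u, congrArg (· *ᵥ u) hb.D_eq⟩ (fun l => ⟨?_, ?_⟩) l
    · refine mem_of_forall_sum_smul_mem hspan Z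
        (a := fun l => (S.B l.succ *ᵥ u, S'.B l.succ *ᵥ u)) (fun ν => ?_) l
      have := (hobs ν.2 ν.1 _ (hGu ν.1 u)).1
      simp only [hN.obs_mulVec_inl, hN'.obs_mulVec_inl, mulVec_zero, zero_add] at this
      rwa [sum_smul_prodMk] at this
    · refine eq_of_forall_sum_smul_eq hspan
        (a := fun l => S.D l.succ *ᵥ u) (b := fun l => S'.D l.succ *ᵥ u) (fun ν => ?_) l
      have := (hobs ν.2 ν.1 _ (hGu ν.1 u)).2
      simpa only [hN.obs_mulVec_inr, hN'.obs_mulVec_inr, mulVec_zero, zero_add] using this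
  exact ⟨Z, fun l u => (hu' u l).1, fun l x hx => (hx' x hx l).1, fun l x hx => (hx' x hx l).2,
    fun l u => (hu' u l).2⟩

theorem ioEquivalent_iff_formallyEquivalent_toLFT {ψ : SchedulingSet np → Fin nψ → ℝ}
    (hψ : LinearIndependent ℝ (oneAndComponents ψ)) (hM : IsRealization M ψ)
    (hN : S.IsSeriesRealization M N) (hN' : S'.IsSeriesRealization M N') :
    IOEquivalent ψ S S' ↔ (S.toLFT N).FormallyEquivalent (S'.toLFT N') := by
  constructor
  · intro h
    obtain ⟨Z, hZ⟩ := h.exists_isBisimulation hψ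
    exact hZ.formallyEquivalent_toLFT hN hN'
  · intro h
    obtain ⟨Z, hZ⟩ := exists_isBisimulation_of_formallyEquivalent_toLFT hψ hM hN hN' h
    exact hZ.ioEquivalent ψ

/-! ### Minimality of the associated LFT -/

theorem IsMinimal.isReachable_toLFT {ψ : SchedulingSet np → Fin nψ → ℝ}
    (hψ : LinearIndependent ℝ (oneAndComponents ψ)) (hM : IsRealization M ψ)
    (hN : S.IsSeriesRealization M N) (h : IsMinimal ψ S) : (S.toLFT N).IsReachable := by
  intro W hB hA
  have hspan := hM.span_range_formalMap_eq_top hψ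
  let W₀ : Submodule ℝ (Fin nx → ℝ) := W none
  let Ws : ∀ i, Submodule ℝ (Fin (N.n i) → ℝ) := fun i => W (some i)
  have hGx : ∀ i, ∀ x ∈ W₀, N.blockB i *ᵥ Sum.elim x 0 ∈ Ws i := by
    intro i x hx
    rw [← toLFT_blockA_some_none S]
    exact hA none (some i) x hx
  have hGu : ∀ i u, N.blockB i *ᵥ Sum.elim 0 u ∈ Ws i := by
    intro i u
    rw [← toLFT_blockB_some S]
    exact hB (some i) u
  have hobs : ∀ w i, ∀ z ∈ Ws i, (N.obs i w *ᵥ z) ∘ Sum.inl ∈ W₀ := fun w i z hz =>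
    N.obs_mulVec_mem N (Z := fun i => (Ws i).comap (LinearMap.fst ℝ _ _))
      (Y := {y | y.1 ∘ Sum.inl ∈ W₀})
      (fun i j x hx => hA (some i) (some j) x.1 hx) (fun i x hx => hA (some i) none x.1 hx) w i
      (z, 0) hz
  have hW₀ : W₀ = ⊤ := by
    refine h.eq_top_of_invariant W₀ (fun l u => ?_) (fun l x hx => ?_)
    · refine Fin.cases (hB none u) (fun l => ?_) l
      refine mem_of_forall_sum_smul_mem hspan W₀ (a := fun l => S.B l.succ *ᵥ u) (fun ν => ?_) l
      simpa only [hN.obs_mulVec_inl, mulVec_zero, zero_add] using hobs ν.2 ν.1 _ (hGu ν.1 u)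
    · refine Fin.cases (hA none none x hx) (fun l => ?_) l
      refine mem_of_forall_sum_smul_mem hspan W₀ (a := fun l => S.A l.succ *ᵥ x) (fun ν => ?_) l
      simpa only [hN.obs_mulVec_inl, mulVec_zero, add_zero] using hobs ν.2 ν.1 _ (hGx ν.1 x hx)
  rintro (_ | i)
  · exact hW₀
  · refine hN.minimal.isReachable Ws (fun i v => ?_)
      (fun i j x hx => hA (some i) (some j) x hx) i
    have hv : v = Sum.elim (v ∘ Sum.inl) (0 : Fin nu → ℝ) +
        Sum.elim (0 : Fin nx → ℝ) (v ∘ Sum.inr) := by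
      funext s
      cases s <;> simp
    rw [hv, mulVec_add]
    exact (Ws i).add_mem (hGx i _ (by rw [hW₀]; trivial)) (hGu i _)

theorem IsMinimal.isObservable_toLFT {ψ : SchedulingSet np → Fin nψ → ℝ}
    (hψ : LinearIndependent ℝ (oneAndComponents ψ)) (hM : IsRealization M ψ)
    (hN : S.IsSeriesRealization M N) (h : IsMinimal ψ S) : (S.toLFT N).IsObservable := by
  intro U hC hA
  have hspan := hM.span_range_formalMap_eq_top hψ
  let U₀ : Submodule ℝ (Fin nx → ℝ) := U none
  let Us : ∀ i, Submodule ℝ (Fin (N.n i) → ℝ) := fun i => U (some i)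
  have hGx : ∀ i, ∀ x ∈ U₀, N.blockB i *ᵥ Sum.elim x 0 ∈ Us i := by
    intro i x hx
    rw [← toLFT_blockA_some_none S]
    exact hA none (some i) x hx
  have hobs : ∀ w i, ∀ z ∈ Us i, (N.obs i w *ᵥ z) ∘ Sum.inl ∈ U₀ ∧
      (N.obs i w *ᵥ z) ∘ Sum.inr = 0 := fun w i z hz =>
    N.obs_mulVec_mem N (Z := fun i => (Us i).comap (LinearMap.fst ℝ _ _))
      (Y := {y | y.1 ∘ Sum.inl ∈ U₀ ∧ y.1 ∘ Sum.inr = 0})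
      (fun i j x hx => hA (some i) (some j) x.1 hx)
      (fun i x hx => ⟨hA (some i) none x.1 hx, hC (some i) x.1 hx⟩) w i (z, 0) hz
  have hU₀ : U₀ = ⊥ := by
    refine h.eq_bot_of_invariant U₀ (fun l x hx => ?_) (fun l x hx => ?_)
    · refine Fin.cases (hC none x hx) (fun l => ?_) l
      refine eq_of_forall_sum_smul_eq hspan (a := fun l => S.C l.succ *ᵥ x) (b := fun _ => 0)
        (fun ν => ?_) l
      simpa only [hN.obs_mulVec_inr, mulVec_zero, add_zero, smul_zero, Finset.sum_const_zero]
        using (hobs ν.2 ν.1 _ (hGx ν.1 x hx)).2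
    · refine Fin.cases (hA none none x hx) (fun l => ?_) l
      refine mem_of_forall_sum_smul_mem hspan U₀ (a := fun l => S.A l.succ *ᵥ x) (fun ν => ?_) l
      simpa only [hN.obs_mulVec_inl, mulVec_zero, add_zero] using
        (hobs ν.2 ν.1 _ (hGx ν.1 x hx)).1
  rintro (_ | i)
  · exact hU₀
  · refine hN.minimal.isObservable Us (fun i z hz => ?_)
      (fun i j x hx => hA (some i) (some j) x hx) i
    obtain ⟨h1, h2⟩ := hobs [] i z hz
    rw [hU₀, Submodule.mem_bot] at h1
    funext s
    cases s with
    | inl a => exact congrFun h1 a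
    | inr a => exact congrFun h2 a

/-- A minimal LFT has the smallest possible blocks, in particular the smallest shift block, and
the shift block of the associated LFT is the state space of the FALPV. -/
theorem isMinimal_iff_isMinimal_toLFT {ψ : SchedulingSet np → Fin nψ → ℝ}
    (hψ : LinearIndependent ℝ (oneAndComponents ψ)) (hM : IsRealization M ψ)
    (hN : S.IsSeriesRealization M N) : IsMinimal ψ S ↔ (S.toLFT N).IsMinimal := by
  constructor
  · intro h
    exact LFT.isMinimal_of_reachable_observable (h.isReachable_toLFT hψ hM hN)
      (h.isObservable_toLFT hψ hM hN)
  · intro h nx' S' hS'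
    obtain ⟨N', hN'⟩ := S'.exists_isSeriesRealization hM.stable hM.D_eq_zero
    exact LFT.n_le_of_reachable_observable h.isReachable h.isObservable
      ((ioEquivalent_iff_formallyEquivalent_toLFT hψ hM hN hN').1 hS'.symm) none

end

end FALPV

theorem theorem1 {np nψ nu ny : ℕ} (ψ : SchedulingSet np → Fin nψ → ℝ)
    (hψ_indep : LinearIndependent ℝ (oneAndComponents ψ))
    (hψ : IsRecognizable ψ) :
    ∀ M : LFT (Fin nψ) (Fin 1) (Fin np), IsRealization M ψ →
      -- the associated LFT can be built for every FALPV
      (∀ (nx : ℕ) (S : FALPV nψ nx nu ny), ∃ N, S.IsSeriesRealization M N) ∧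
      -- (1) solutions of the FALPV extend uniquely to solutions of the LFT
      (∀ (nx : ℕ) (S : FALPV nψ nx nu ny)
        (N : LFT (Fin nx ⊕ Fin ny) (Fin nx ⊕ Fin nu) (Fin np)), S.IsSeriesRealization M N →
        ∀ (x : ℕ → Fin nx → ℝ) (y : ℕ → Fin ny → ℝ) (u : ℕ → Fin nu → ℝ)
          (p : ℕ → SchedulingSet np), S.IsSolution ψ x y u p →
          (∃! z : ℕ → (S.toLFT N).Coord → ℝ,
            (S.toLFT N).IsSolutionFrom (schedulingUncertainty p)
              (S.initialSignal N (x 0)) z y u ∧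
            ∃ zt : ℕ → N.Coord → ℝ, z = S.joinSignal N (fun t => x (t + 1)) zt) ∧
          (x 0 = 0 → ∃! z : ℕ → (S.toLFT N).Coord → ℝ,
            (S.toLFT N).IsSolution (schedulingUncertainty p) z y u ∧
            ∃ zt : ℕ → N.Coord → ℝ, z = S.joinSignal N (fun t => x (t + 1)) zt)) ∧
      -- (2) input-output equivalence is formal input-output equivalence of the LFTs
      (∀ (nx nx' : ℕ) (S : FALPV nψ nx nu ny) (S' : FALPV nψ nx' nu ny)
        (N : LFT (Fin nx ⊕ Fin ny) (Fin nx ⊕ Fin nu) (Fin np))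
        (N' : LFT (Fin nx' ⊕ Fin ny) (Fin nx' ⊕ Fin nu) (Fin np)),
        S.IsSeriesRealization M N → S'.IsSeriesRealization M N' →
        (FALPV.IOEquivalent ψ S S' ↔ (S.toLFT N).FormallyEquivalent (S'.toLFT N'))) ∧
      -- (3) minimality
      (∀ (nx : ℕ) (S : FALPV nψ nx nu ny)
        (N : LFT (Fin nx ⊕ Fin ny) (Fin nx ⊕ Fin nu) (Fin np)), S.IsSeriesRealization M N →
        (FALPV.IsMinimal ψ S ↔ (S.toLFT N).IsMinimal)) := by
  intro M hM
  refine ⟨fun nx S => S.exists_isSeriesRealization hM.stable hM.D_eq_zero,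
    fun nx S N hN x y u p h => ⟨hN.existsUnique_solution hM h, fun h0 => ?_⟩,
    fun nx nx' S S' N N' hN hN' =>
      FALPV.ioEquivalent_iff_formallyEquivalent_toLFT hψ_indep hM hN hN',
    fun nx S N hN => FALPV.isMinimal_iff_isMinimal_toLFT hψ_indep hM hN⟩
  have := hN.existsUnique_solution hM h
  rwa [h0, FALPV.initialSignal_zero] at this
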